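/- **Theorem.** Let $X$ and $B$ be categories with (chosen) finite products, with terminal objects $I$, and let $P:X\to B$ be a cartesian monoidal opfibration. This means: $P$ is an opfibration equipped with a cleavage, i.e. a chosen cocartesian lifting $\hat f_x:x\to f_*x$ of every $f:A\to A'$ in $B$ at every object $x$ over $A$; $P$ strictly preserves the terminal object, binary products and their projections; and products of cocartesian arrows are cocartesian. Let $F:B\to\mathbf{CAT}$ be the associated pseudofunctor, so that $F(A)$ is the fibre of $P$ over $A$ and $F(f)=f_*$. For objects $A,C$ of $B$ let $R^{A,C}:F(A)\times F(C)\to F(A\times C)$ be the product in $X$ and $R^1:\mathbf 1\to F(I)$ the terminal object of $X$. They have left adjoints $L^{A,C}=\langle (\pi_1)_*,(\pi_2)_*\rangle$ and $L^1:F(I)\to\mathbf 1$. The unit $\eta^{A,C}:1\Rightarrow R^{A,C}L^{A,C}$ has as component at $z$ the arrow $\langle\hat\pi_1,\hat\pi_2\rangle:z\to(\pi_1)_*z\times(\pi_2)_*z$; the unit $\eta^1:1\Rightarrow R^1L^1$ has as component at $z$ the arrow $z\to I$. For every internal monoid $(M,m,e)$ of $B$ the fibre $F(M)$ is a monoidal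 category with tensor product $F(m)\circ R^{M,M}$ and unit $E=F(e)\circ R^1$ (the constraints being the unique vertical arrows compatible with those of the products in $X$). For every morphism $f$ of internal monoids $F(f)$ is strong monoidal, and this gives a pseudofunctor $\mathrm{Mon}(F):\mathrm{Mon}(B)\to\mathbf{MonCAT}$ to the 2-category of monoidal categories, strong monoidal functors and monoidal natural transformations. A *2-group* is a monoidal category which is a groupoid and in which every object $x$ has an object $y$ with $x\otimes y\cong E\cong y\otimes x$; let $\mathbf{2Gp}$ be the full sub-2-category of $\mathbf{MonCAT}$ on the 2-groups. Call $F$ *groupal* if it sends internal groups to 2-groups, i.e. if there is a pseudofunctor $\mathrm{Gp}(B)\to\mathbf{2Gp}$, on the category of internal groups of $B$, whose composite with $\mathbf{2Gp}\to\mathbf{MonCAT}$ is the restriction of $\mathrm{Mon}(F)$ to $\mathrm{Gp}(B)$ and whose composite with $\mathbf{2Gp}\to\mathbf{CAT}$ is the composite of $F$ with $\mathrm{Gp}(B)\to B$. Then the following are equivalent: 1. $\eta^1$ is an isomorphism, and $\eta^{A,A}:1\Rightarrow R^{A,A}L^{A,A}$ is an isomorphism for every object $A$ of $B$ that admits an internal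 group structure; 2. $F$ is groupal; 3. $F$ lifts to some pseudofunctor $\mathrm{Gp}(B)\to\mathbf{2Gp}$, i.e. there is a pseudofunctor $\mathrm{Gp}(B)\to\mathbf{2Gp}$ whose composite with the forgetful $\mathbf{2Gp}\to\mathbf{CAT}$ equals the composite of $\mathrm{Gp}(B)\to B$ with $F$. Moreover, if $F$ is groupal, then for every internal group $A$ of $B$, with inversion $i:A\to A$, the functor $F(i):F(A)\to F(A)$ provides pseudoinverses in $F(A)$: there are isomorphisms $\gamma_x:E\to x\otimes F(i)(x)$ and $\delta_x:F(i)(x)\otimes x\to E$, natural in $x\in F(A)$, satisfying the triangle identities. -/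

import Mathlib

open CategoryTheory

universe v₁ v₂ u₁ u₂

namespace GroupalOpfib

section Opfibration

variable {X : Type u₁} [Category.{v₁} X] {B : Type u₂} [Category.{v₂} B] {P : X ⥤ B}

/-- A (Grothendieck) cloven opfibration: the functor `P` together with a chosen (strongly)
cocartesian lifting `hat f x : x ⟶ f_* x` of every `f : A ⟶ A'` at every object `x` over `A`.
The cleavage is neither assumed to be normal nor split. -/
structure Cleavage (P : X ⥤ B) where
  /-- the object `f_* x` -/
  push {A A' : B} (f : A ⟶ A') (x : P.Fiber A) : P.Fiber A'
  /-- the lifting `x ⟶ f_* x` -/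
  hat {A A' : B} (f : A ⟶ A') (x : P.Fiber A) : x.1 ⟶ (push f x).1
  cocart {A A' : B} (f : A ⟶ A') (x : P.Fiber A) : P.IsStronglyCocartesian f (hat f x)

@[simp] theorem comp_val {A : B} {x y z : P.Fiber A} (f : x ⟶ y) (g : y ⟶ z) :
    (f ≫ g).1 = f.1 ≫ g.1 := rfl

@[simp] theorem id_val {A : B} (x : P.Fiber A) : (𝟙 x : x ⟶ x).1 = 𝟙 x.1 := rfl

/-- The vertical arrow induced by a cocartesian arrow `φ` over `f` and another arrow over `f`. -/
noncomputable def desc {A C : B} {w : X} {z z' : P.Fiber A} (f : C ⟶ A) (φ : w ⟶ z.1)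
    (hφ : P.IsStronglyCocartesian f φ) (χ : w ⟶ z'.1) (hχ : P.IsHomLift f χ) : z ⟶ z' :=
  ⟨Functor.IsCocartesian.map P f φ χ, Functor.IsCocartesian.map_isHomLift P f φ χ⟩

@[simp] theorem fac {A C : B} {w : X} {z z' : P.Fiber A} (f : C ⟶ A) (φ : w ⟶ z.1)
    (hφ : P.IsStronglyCocartesian f φ) (χ : w ⟶ z'.1) (hχ : P.IsHomLift f χ) :
    φ ≫ (desc f φ hφ χ hχ).1 = χ :=
  Functor.IsCocartesian.fac P f φ χ

@[simp] theorem fac_assoc {A C : B} {w t : X} {z z' : P.Fiber A} (f : C ⟶ A) (φ : w ⟶ z.1)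
    (hφ : P.IsStronglyCocartesian f φ) (χ : w ⟶ z'.1) (hχ : P.IsHomLift f χ) (k : z'.1 ⟶ t) :
    φ ≫ (desc f φ hφ χ hχ).1 ≫ k = χ ≫ k := by
  rw [← Category.assoc, fac]

theorem vert_ext {A C : B} {w : X} {z z' : P.Fiber A} (f : C ⟶ A) (φ : w ⟶ z.1)
    (hφ : P.IsStronglyCocartesian f φ) {a b : z ⟶ z'} (h : φ ≫ a.1 = φ ≫ b.1) : a = b := by
  have := a.2
  have := b.2
  exact Subtype.ext (Functor.IsStronglyCocartesian.ext P f φ (𝟙 A) h)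

/-- The vertical isomorphism between the codomains of two cocartesian arrows over `f`. -/
noncomputable def descIso {A C : B} {w : X} {z z' : P.Fiber A} (f : C ⟶ A) (φ : w ⟶ z.1)
    (hφ : P.IsStronglyCocartesian f φ) (χ : w ⟶ z'.1) (hχ : P.IsStronglyCocartesian f χ) :
    z ≅ z' where
  hom := desc f φ hφ χ hχ.toIsHomLift
  inv := desc f χ hχ φ hφ.toIsHomLift
  hom_inv_id := vert_ext f φ hφ (by simp)
  inv_hom_id := vert_ext f χ hχ (by simp)

theorem cocart_comp {A C D : B} {x y z : X} {f : A ⟶ C} {g : C ⟶ D} {φ : x ⟶ y} {ψ : y ⟶ z}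
    (h : P.IsStronglyCocartesian f φ) (h' : P.IsStronglyCocartesian g ψ) :
    P.IsStronglyCocartesian (f ≫ g) (φ ≫ ψ) := inferInstance

theorem homLift_comp {A C D : B} {x y z : X} {f : A ⟶ C} {g : C ⟶ D} {φ : x ⟶ y} {ψ : y ⟶ z}
    (h : P.IsHomLift f φ) (h' : P.IsHomLift g ψ) :
    P.IsHomLift (f ≫ g) (φ ≫ ψ) := inferInstance

theorem homLift_vert_comp {A C : B} {z : X} {a b : P.Fiber A} {f : A ⟶ C} (k : a ⟶ b)
    {ψ : b.1 ⟶ z} (h : P.IsHomLift f ψ) : P.IsHomLift f (k.1 ≫ ψ) := by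
  have := k.2
  infer_instance

theorem cocart_id {A : B} (x : P.Fiber A) : P.IsStronglyCocartesian (𝟙 A) (𝟙 x.1) := by
  have : P.IsHomLift (𝟙 A) (𝟙 x.1) := IsHomLift.id x.2
  infer_instance

namespace Cleavage

variable (c : Cleavage P)

theorem hat_lift {A A' : B} (f : A ⟶ A') (x : P.Fiber A) : P.IsHomLift f (c.hat f x) :=
  (c.cocart f x).toIsHomLift

/-- The action of `f_*` on vertical arrows. -/
noncomputable def pushMap {A A' : B} (f : A ⟶ A') {x y : P.Fiber A} (k : x ⟶ y) :
    c.push f x ⟶ c.push f y :=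
  desc f (c.hat f x) (c.cocart f x) (k.1 ≫ c.hat f y) (homLift_vert_comp k (c.hat_lift f y))

/-- The vertical comparison `1_* x ≅ x`. -/
noncomputable def idIso {A : B} (x : P.Fiber A) : c.push (𝟙 A) x ≅ x :=
  descIso (𝟙 A) (c.hat (𝟙 A) x) (c.cocart _ x) (𝟙 x.1) (cocart_id x)

/-- The vertical comparison `(g f)_* x ≅ g_* f_* x`. -/
noncomputable def compIso {A A' A'' : B} (f : A ⟶ A') (g : A' ⟶ A'') (x : P.Fiber A) :
    c.push (f ≫ g) x ≅ c.push g (c.push f x) :=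
  descIso (f ≫ g) (c.hat (f ≫ g) x) (c.cocart _ x)
      (c.hat f x ≫ c.hat g (c.push f x)) (cocart_comp (c.cocart f x) (c.cocart g _))

/-- The vertical comparison `f_* x ⟶ g_* x` for equal arrows `f = g` of the base. -/
noncomputable def eqMap {A A' : B} {f g : A ⟶ A'} (h : f = g) (x : P.Fiber A) :
    c.push f x ⟶ c.push g x :=
  desc f (c.hat f x) (c.cocart f x) (c.hat g x) (h ▸ c.hat_lift g x)

@[simp] theorem hat_pushMap {A A' : B} (f : A ⟶ A') {x y : P.Fiber A} (k : x ⟶ y) :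
    c.hat f x ≫ (c.pushMap f k).1 = k.1 ≫ c.hat f y := by
  exact fac f _ (c.cocart _ x) _ _

@[simp] theorem hat_pushMap_assoc {A A' : B} (f : A ⟶ A') {x y : P.Fiber A} (k : x ⟶ y) {t : X}
    (l : (c.push f y).1 ⟶ t) :
    c.hat f x ≫ (c.pushMap f k).1 ≫ l = k.1 ≫ c.hat f y ≫ l := by
  have := congrArg (· ≫ l) (c.hat_pushMap f k)
  simpa only [Category.assoc, Category.id_comp] using this

@[simp] theorem hat_idIso {A : B} (x : P.Fiber A) :
    c.hat (𝟙 A) x ≫ (c.idIso x).hom.1 = 𝟙 _ := by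
  exact fac (𝟙 A) _ (c.cocart _ x) _ _

@[simp] theorem hat_idIso_assoc {A : B} (x : P.Fiber A) {t : X}
    (k : x.1 ⟶ t) :
    c.hat (𝟙 A) x ≫ (c.idIso x).hom.1 ≫ k = k := by
  have := congrArg (· ≫ k) (c.hat_idIso x)
  simpa only [Category.assoc, Category.id_comp] using this

@[simp] theorem hat_compIso {A A' A'' : B} (f : A ⟶ A') (g : A' ⟶ A'') (x : P.Fiber A) :
    c.hat (f ≫ g) x ≫ (c.compIso f g x).hom.1 = c.hat f x ≫ c.hat g (c.push f x) := by
  exact fac (f ≫ g) _ (c.cocart _ x) _ _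

@[simp] theorem hat_compIso_assoc {A A' A'' : B} (f : A ⟶ A') (g : A' ⟶ A'') (x : P.Fiber A) {t : X}
    (k : (c.push g (c.push f x)).1 ⟶ t) :
    c.hat (f ≫ g) x ≫ (c.compIso f g x).hom.1 ≫ k = c.hat f x ≫ c.hat g (c.push f x) ≫ k := by
  have := congrArg (· ≫ k) (c.hat_compIso f g x)
  simpa only [Category.assoc, Category.id_comp] using this

@[simp] theorem hat_compIso_inv {A A' A'' : B} (f : A ⟶ A') (g : A' ⟶ A'') (x : P.Fiber A) :
    c.hat f x ≫ c.hat g (c.push f x) ≫ (c.compIso f g x).inv.1 = c.hat (f ≫ g) x := by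
  rw [← Category.assoc]
  exact fac (f ≫ g) _ (cocart_comp (c.cocart f x) (c.cocart g _)) _ _

@[simp] theorem hat_compIso_inv_assoc {A A' A'' : B} (f : A ⟶ A') (g : A' ⟶ A'') (x : P.Fiber A) {t : X}
    (k : (c.push (f ≫ g) x).1 ⟶ t) :
    c.hat f x ≫ c.hat g (c.push f x) ≫ (c.compIso f g x).inv.1 ≫ k = c.hat (f ≫ g) x ≫ k := by
  have := congrArg (· ≫ k) (c.hat_compIso_inv f g x)
  simpa only [Category.assoc, Category.id_comp] using this

@[simp] theorem hat_eqMap {A A' : B} {f g : A ⟶ A'} (h : f = g) (x : P.Fiber A) :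
    c.hat f x ≫ (c.eqMap h x).1 = c.hat g x := by
  exact fac f _ (c.cocart _ x) _ _

@[simp] theorem hat_eqMap_assoc {A A' : B} {f g : A ⟶ A'} (h : f = g) (x : P.Fiber A) {t : X}
    (k : (c.push g x).1 ⟶ t) :
    c.hat f x ≫ (c.eqMap h x).1 ≫ k = c.hat g x ≫ k := by
  have := congrArg (· ≫ k) (c.hat_eqMap h x)
  simpa only [Category.assoc, Category.id_comp] using this

/-- The change of base functor `f_* : F(A) ⥤ F(A')`. -/
noncomputable def pushFunctor {A A' : B} (f : A ⟶ A') : P.Fiber A ⥤ P.Fiber A' where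
  obj x := c.push f x
  map k := c.pushMap f k
  map_id x := vert_ext f _ (c.cocart f x) (by simp)
  map_comp k l := vert_ext f _ (c.cocart f _) (by simp)

/-- The natural isomorphism `1_* ≅ 1`. -/
noncomputable def pushId (A : B) : c.pushFunctor (𝟙 A) ≅ 𝟭 (P.Fiber A) :=
  NatIso.ofComponents (fun x => c.idIso x) (fun {x y} k => vert_ext (𝟙 A) _ (c.cocart _ x) (by
    change c.hat _ x ≫ (c.pushMap _ k).1 ≫ (c.idIso y).hom.1 = c.hat _ x ≫ (c.idIso x).hom.1 ≫ k.1
    simp))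

/-- The natural isomorphism `(g f)_* ≅ g_* f_*`. -/
noncomputable def pushComp {A A' A'' : B} (f : A ⟶ A') (g : A' ⟶ A'') :
    c.pushFunctor (f ≫ g) ≅ c.pushFunctor f ⋙ c.pushFunctor g :=
  NatIso.ofComponents (fun x => c.compIso f g x)
    (fun {x y} k => vert_ext (f ≫ g) _ (c.cocart _ x) (by
      change c.hat _ x ≫ (c.pushMap _ k).1 ≫ (c.compIso f g y).hom.1 =
        c.hat _ x ≫ (c.compIso f g x).hom.1 ≫ (c.pushMap g (c.pushMap f k)).1
      simp))

/-- The natural transformation `f_* ⟶ g_*` for equal arrows `f = g` of the base. -/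
noncomputable def pushEq {A A' : B} {f g : A ⟶ A'} (h : f = g) :
    c.pushFunctor f ⟶ c.pushFunctor g where
  app x := c.eqMap h x
  naturality x y k := vert_ext f _ (c.cocart f x) (by
    change c.hat _ x ≫ (c.pushMap _ k).1 ≫ (c.eqMap h y).1 =
      c.hat _ x ≫ (c.eqMap h x).1 ≫ (c.pushMap _ k).1
    simp)

theorem as_eq {A A' : LocallyDiscrete B} {f g : A ⟶ A'} (η : f ⟶ g) : f.as = g.as :=
  congrArg Discrete.as (LocallyDiscrete.eq_of_hom η)

section
open scoped Bicategory

/-- The pseudofunctor `F : B ⥤ CAT` associated with a cloven opfibration: `F(A)` is the fibre over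
`A` and `F(f) = f_*`. -/
noncomputable def pseudofunctor : LocallyDiscrete B ⥤ᵖ Cat.{v₁, u₁} where
  obj A := Cat.of (P.Fiber A.as)
  map f := (c.pushFunctor f.as).toCatHom
  map₂ η := (c.pushEq (as_eq η)).toCatHom₂
  map₂_id f := by
    refine Cat.Hom₂.ext (NatTrans.ext (funext fun (x : P.Fiber _) => ?_))
    refine vert_ext f.as _ (c.cocart _ x) ?_
    change c.hat f.as x ≫ (c.eqMap rfl x).1 = c.hat f.as x ≫ 𝟙 _
    simp
  map₂_comp {_ _ f g h} η θ := by
    refine Cat.Hom₂.ext (NatTrans.ext (funext fun (x : P.Fiber _) => ?_))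
    refine vert_ext f.as _ (c.cocart _ x) ?_
    change c.hat f.as x ≫ (c.eqMap (as_eq (η ≫ θ)) x).1 =
      c.hat f.as x ≫ (c.eqMap (as_eq η) x).1 ≫ (c.eqMap (as_eq θ) x).1
    simp
  mapId A := Cat.Hom.isoMk (c.pushId A.as)
  mapComp f g := Cat.Hom.isoMk (c.pushComp f.as g.as)
  map₂_whisker_left {_ _ _} f {g h} η := by
    refine Cat.Hom₂.ext (NatTrans.ext (funext fun (x : P.Fiber _) => ?_))
    refine vert_ext (f.as ≫ g.as) _ (c.cocart _ x) ?_
    change c.hat (f.as ≫ g.as) x ≫ (c.eqMap (as_eq (f ◁ η)) x).1 =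
      c.hat (f.as ≫ g.as) x ≫ (c.compIso f.as g.as x).hom.1 ≫
        (c.eqMap (as_eq η) (c.push f.as x)).1 ≫ (c.compIso f.as h.as x).inv.1
    simp
  map₂_whisker_right {_ _ _} {f g} η h := by
    refine Cat.Hom₂.ext (NatTrans.ext (funext fun (x : P.Fiber _) => ?_))
    refine vert_ext (f.as ≫ h.as) _ (c.cocart _ x) ?_
    change c.hat (f.as ≫ h.as) x ≫ (c.eqMap (as_eq (η ▷ h)) x).1 =
      c.hat (f.as ≫ h.as) x ≫ (c.compIso f.as h.as x).hom.1 ≫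
        (c.pushMap h.as (c.eqMap (as_eq η) x)).1 ≫ (c.compIso g.as h.as x).inv.1
    simp
  map₂_associator f g h := by
    refine Cat.Hom₂.ext (NatTrans.ext (funext fun (x : P.Fiber _) => ?_))
    refine vert_ext ((f.as ≫ g.as) ≫ h.as) _ (c.cocart _ x) ?_
    change c.hat ((f.as ≫ g.as) ≫ h.as) x ≫ (c.eqMap (as_eq (α_ f g h).hom) x).1 =
      c.hat ((f.as ≫ g.as) ≫ h.as) x ≫ (c.compIso (f.as ≫ g.as) h.as x).hom.1 ≫
        (c.pushMap h.as (c.compIso f.as g.as x).hom).1 ≫ 𝟙 _ ≫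
          (c.compIso g.as h.as (c.push f.as x)).inv.1 ≫
            (c.compIso f.as (g.as ≫ h.as) x).inv.1
    simp
  map₂_left_unitor f := by
    refine Cat.Hom₂.ext (NatTrans.ext (funext fun (x : P.Fiber _) => ?_))
    refine vert_ext (𝟙 _ ≫ f.as) _ (c.cocart _ x) ?_
    change c.hat (𝟙 _ ≫ f.as) x ≫ (c.eqMap (as_eq (λ_ f).hom) x).1 =
      c.hat (𝟙 _ ≫ f.as) x ≫ (c.compIso (𝟙 _) f.as x).hom.1 ≫
        (c.pushMap f.as (c.idIso x).hom).1 ≫ 𝟙 _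
    simp
  map₂_right_unitor f := by
    refine Cat.Hom₂.ext (NatTrans.ext (funext fun (x : P.Fiber _) => ?_))
    refine vert_ext (f.as ≫ 𝟙 _) _ (c.cocart _ x) ?_
    change c.hat (f.as ≫ 𝟙 _) x ≫ (c.eqMap (as_eq (ρ_ f).hom) x).1 =
      c.hat (f.as ≫ 𝟙 _) x ≫ (c.compIso f.as (𝟙 _) x).hom.1 ≫
        (c.idIso (c.push f.as x)).hom.1 ≫ 𝟙 _
    simp
end

end Cleavage
end Opfibration

/-- A monoidal category, as an object of the 2-category of monoidal categories. -/
structure MonCAT where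
  carrier : Type u₁
  [category : Category.{v₁} carrier]
  [monoidal : MonoidalCategory carrier]

namespace MonCAT

attribute [instance] MonCAT.category MonCAT.monoidal

/-- A strong monoidal functor. -/
structure Hom (C D : MonCAT.{v₁, u₁}) where
  functor : C.carrier ⥤ D.carrier
  [monoidal : functor.Monoidal]

attribute [instance] Hom.monoidal

/-- A monoidal natural transformation. -/
@[ext]
structure Hom₂ {C D : MonCAT.{v₁, u₁}} (F G : Hom C D) where
  natTrans : F.functor ⟶ G.functor
  [isMonoidal : NatTrans.IsMonoidal natTrans]

attribute [instance] Hom₂.isMonoidal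

instance categoryStruct : CategoryStruct MonCAT.{v₁, u₁} where
  Hom C D := Hom C D
  id C := { functor := 𝟭 C.carrier }
  comp F G := { functor := F.functor ⋙ G.functor }

instance homCategory (C D : MonCAT.{v₁, u₁}) : Category (C ⟶ D) where
  Hom F G := Hom₂ F G
  id F := { natTrans := 𝟙 F.functor }
  comp α β := { natTrans := α.natTrans ≫ β.natTrans }

/-- The functor underlying a 1-cell. -/
def toFunctor {C D : MonCAT.{v₁, u₁}} (F : C ⟶ D) : C.carrier ⥤ D.carrier := Hom.functor F

instance {C D : MonCAT.{v₁, u₁}} (F : C ⟶ D) : (toFunctor F).Monoidal := Hom.monoidal F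

/-- The natural transformation underlying a 2-cell. -/
def toNatTrans {C D : MonCAT.{v₁, u₁}} {F G : C ⟶ D} (α : F ⟶ G) : toFunctor F ⟶ toFunctor G :=
  Hom₂.natTrans α

instance {C D : MonCAT.{v₁, u₁}} {F G : C ⟶ D} (α : F ⟶ G) :
    NatTrans.IsMonoidal (toNatTrans α) := Hom₂.isMonoidal α

theorem hom₂_ext {C D : MonCAT.{v₁, u₁}} {F G : C ⟶ D} {α β : F ⟶ G}
    (h : toNatTrans α = toNatTrans β) : α = β :=
  Hom₂.ext h

/-- A strong monoidal functor as a 1-cell. -/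
def homMk {C D : MonCAT.{v₁, u₁}} (F : C.carrier ⥤ D.carrier) (h : F.Monoidal) : C ⟶ D :=
  { functor := F, monoidal := h : Hom C D }

/-- A monoidal natural transformation as a 2-cell. -/
def homMk₂ {C D : MonCAT.{v₁, u₁}} {F G : C ⟶ D} (α : toFunctor F ⟶ toFunctor G)
    (h : NatTrans.IsMonoidal α) : F ⟶ G :=
  { natTrans := α, isMonoidal := h : Hom₂ F G }

/-- A monoidal natural isomorphism as an invertible 2-cell. -/
def isoMk {C D : MonCAT.{v₁, u₁}} {F G : C ⟶ D} (e : toFunctor F ≅ toFunctor G)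
    (h : NatTrans.IsMonoidal e.hom) : F ≅ G where
  hom := homMk₂ e.hom h
  inv := homMk₂ e.inv inferInstance
  hom_inv_id := hom₂_ext e.hom_inv_id
  inv_hom_id := hom₂_ext e.inv_hom_id

/-- The 2-category of monoidal categories, strong monoidal functors and monoidal natural
transformations. -/
instance bicategory : Bicategory MonCAT.{v₁, u₁} where
  whiskerLeft F G H α :=
    homMk₂ (F := F ≫ G) (G := F ≫ H) (Functor.whiskerLeft (toFunctor F) (toNatTrans α))
      (NatTrans.IsMonoidal.whiskerLeft (F₁ := toFunctor F) (toNatTrans α))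
  whiskerRight {_ _ _ F G} α H :=
    homMk₂ (F := F ≫ H) (G := G ≫ H) (Functor.whiskerRight (toNatTrans α) (toFunctor H))
      (NatTrans.IsMonoidal.whiskerRight (G₁ := toFunctor H) (toNatTrans α))
  associator F G H := isoMk (F := (F ≫ G) ≫ H) (G := F ≫ (G ≫ H))
    (Functor.associator (toFunctor F) (toFunctor G) (toFunctor H))
    (inferInstanceAs (NatTrans.IsMonoidal
      (Functor.associator (toFunctor F) (toFunctor G) (toFunctor H)).hom))
  leftUnitor {C _} F := isoMk (F := 𝟙 C ≫ F) (G := F) (toFunctor F).leftUnitor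
    (inferInstanceAs (NatTrans.IsMonoidal (toFunctor F).leftUnitor.hom))
  rightUnitor {_ D} F := isoMk (F := F ≫ 𝟙 D) (G := F) (toFunctor F).rightUnitor
    (inferInstanceAs (NatTrans.IsMonoidal (toFunctor F).rightUnitor.hom))
  whiskerLeft_id _ _ := Hom₂.ext (NatTrans.ext (funext fun _ => rfl))
  whiskerLeft_comp _ _ _ _ _ _ := Hom₂.ext (NatTrans.ext (funext fun _ => rfl))
  id_whiskerLeft _ := Hom₂.ext (NatTrans.ext (funext fun _ =>
    ((Category.id_comp _).trans (Category.comp_id _)).symm))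
  comp_whiskerLeft _ _ _ _ _ := Hom₂.ext (NatTrans.ext (funext fun _ =>
    ((Category.id_comp _).trans (Category.comp_id _)).symm))
  id_whiskerRight _ H := Hom₂.ext (NatTrans.ext (funext fun _ => (toFunctor H).map_id _))
  comp_whiskerRight α β H := Hom₂.ext (NatTrans.ext (funext fun x =>
    (toFunctor H).map_comp ((toNatTrans α).app x) ((toNatTrans β).app x)))
  whiskerRight_id _ := Hom₂.ext (NatTrans.ext (funext fun _ =>
    ((Category.id_comp _).trans (Category.comp_id _)).symm))
  whiskerRight_comp _ _ _ := Hom₂.ext (NatTrans.ext (funext fun _ =>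
    ((Category.id_comp _).trans (Category.comp_id _)).symm))
  whisker_assoc _ _ _ _ _ := Hom₂.ext (NatTrans.ext (funext fun _ =>
    ((Category.id_comp _).trans (Category.comp_id _)).symm))
  whisker_exchange α β := Hom₂.ext (NatTrans.ext (funext fun x =>
    ((toNatTrans β).naturality ((toNatTrans α).app x)).symm))
  pentagon F G H K := Hom₂.ext (Functor.pentagon (toFunctor F) (toFunctor G) (toFunctor H)
    (toFunctor K))
  triangle F G := Hom₂.ext (Functor.triangle (toFunctor F) (toFunctor G))

section
open scoped Bicategory

/-- The forgetful pseudofunctor from monoidal categories to categories. -/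
def forget : MonCAT.{v₁, u₁} ⥤ᵖ Cat.{v₁, u₁} where
  obj C := Cat.of C.carrier
  map F := (toFunctor F).toCatHom
  map₂ α := (toNatTrans α).toCatHom₂
  mapId _ := Iso.refl _
  mapComp _ _ := Iso.refl _
  map₂_whisker_left _ _ _ _ := by
    refine Cat.Hom₂.ext (NatTrans.ext (funext fun _ => ?_))
    exact ((Category.id_comp _).trans (Category.comp_id _)).symm
  map₂_whisker_right _ _ := by
    refine Cat.Hom₂.ext (NatTrans.ext (funext fun _ => ?_))
    exact ((Category.id_comp _).trans (Category.comp_id _)).symm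
  map₂_associator _ _ H := by
    refine Cat.Hom₂.ext (NatTrans.ext (funext fun x => ?_))
    change 𝟙 _ = 𝟙 _ ≫ (toFunctor H).map (𝟙 _) ≫ 𝟙 _ ≫ 𝟙 _ ≫ 𝟙 _
    simp
  map₂_left_unitor F := by
    refine Cat.Hom₂.ext (NatTrans.ext (funext fun x => ?_))
    change 𝟙 _ = 𝟙 _ ≫ (toFunctor F).map (𝟙 _) ≫ 𝟙 _
    rw [Category.id_comp, Category.comp_id]
    exact ((toFunctor F).map_id x).symm
  map₂_right_unitor F := by
    refine Cat.Hom₂.ext (NatTrans.ext (funext fun x => ?_))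
    change 𝟙 _ = 𝟙 _ ≫ 𝟙 _ ≫ 𝟙 _
    simp

end
end MonCAT

section TwoGroups

open MonoidalCategory
open scoped Bicategory

/-- A 2-group is a monoidal groupoid in which every object is weakly invertible for the tensor
product. -/
structure IsTwoGroup (C : Type u₁) [Category.{v₁} C] [MonoidalCategory C] : Prop where
  isGroupoid : IsGroupoid C
  exists_inverse (x : C) : ∃ y : C, Nonempty (x ⊗ y ≅ 𝟙_ C) ∧ Nonempty (y ⊗ x ≅ 𝟙_ C)

/-- The 2-category of 2-groups: the full sub-2-category of monoidal categories on the 2-groups. -/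
abbrev TwoGrp : Type max (u₁ + 1) (v₁ + 1) :=
  Bicategory.InducedBicategory MonCAT.{v₁, u₁}
    (fun C : {C : MonCAT.{v₁, u₁} // IsTwoGroup C.carrier} => C.1)

/-- The inclusion of 2-groups in monoidal categories. -/
def TwoGrp.toMonCAT : TwoGrp.{v₁, u₁} ⥤ᵖ MonCAT.{v₁, u₁} :=
  Bicategory.InducedBicategory.forget.toPseudofunctor

/-- The forgetful pseudofunctor from 2-groups to categories. -/
def TwoGrp.toCat : TwoGrp.{v₁, u₁} ⥤ᵖ Cat.{v₁, u₁} :=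
  TwoGrp.toMonCAT.comp MonCAT.forget

end TwoGroups

section Cartesian

open MonoidalCategory CartesianMonoidalCategory

variable {X : Type u₁} [Category.{v₁} X] [CartesianMonoidalCategory X]
  {B : Type u₂} [Category.{v₂} B] [CartesianMonoidalCategory B] {P : X ⥤ B}

/-- `P` is strictly monoidal for the (chosen) cartesian monoidal structures, i.e. it strictly
preserves the terminal object, binary products and their projections, and products of cocartesian
arrows are cocartesian. A cloven opfibration with this property is a cartesian monoidal
opfibration. -/
structure IsCartesianMonoidal (P : X ⥤ B) : Prop where
  obj_unit : P.obj (𝟙_ X) = 𝟙_ B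
  fst_lift (x y : X) : P.IsHomLift (fst (P.obj x) (P.obj y)) (fst x y)
  snd_lift (x y : X) : P.IsHomLift (snd (P.obj x) (P.obj y)) (snd x y)
  tensor_cocart {A A' C C' : B} {x x' y y' : X} {f : A ⟶ A'} {g : C ⟶ C'} {φ : x ⟶ x'}
    {ψ : y ⟶ y'} (hφ : P.IsStronglyCocartesian f φ) (hψ : P.IsStronglyCocartesian g ψ) :
    P.IsStronglyCocartesian (f ⊗ₘ g) (φ ⊗ₘ ψ)

namespace IsCartesianMonoidal

theorem obj_tensor (h : IsCartesianMonoidal P) {A C : B} {x y : X} (hx : P.obj x = A) (hy : P.obj y = C) :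
    P.obj (x ⊗ y) = A ⊗ C := by
  subst hx hy
  have := h.fst_lift x y
  exact IsHomLift.domain_eq P (fst (P.obj x) (P.obj y)) (fst x y)

theorem fst_lift' (h : IsCartesianMonoidal P) {A C : B} {x y : X} (hx : P.obj x = A) (hy : P.obj y = C) :
    P.IsHomLift (fst A C) (fst x y) := by
  subst hx hy
  exact h.fst_lift x y

theorem snd_lift' (h : IsCartesianMonoidal P) {A C : B} {x y : X} (hx : P.obj x = A) (hy : P.obj y = C) :
    P.IsHomLift (snd A C) (snd x y) := by
  subst hx hy
  exact h.snd_lift x y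

theorem lift_lift (h : IsCartesianMonoidal P) {A C D : B} {w x y : X} {f : D ⟶ A} {g : D ⟶ C} {φ : w ⟶ x} {ψ : w ⟶ y}
    (hφ : P.IsHomLift f φ) (hψ : P.IsHomLift g ψ) : P.IsHomLift (lift f g) (lift φ ψ) := by
  obtain ⟨⟩ := hφ
  obtain rfl := IsHomLift.codomain_eq P g ψ
  obtain rfl := IsHomLift.eq_of_isHomLift P g ψ
  have h1 := h.fst_lift x y
  have h2 := h.snd_lift x y
  refine IsHomLift.of_commsq P _ _ rfl (h.obj_tensor rfl rfl) ?_
  have e1 := IsHomLift.fac P (fst (P.obj x) (P.obj y)) (fst x y)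
  have e2 := IsHomLift.fac P (snd (P.obj x) (P.obj y)) (snd x y)
  rw [eqToHom_refl, Category.id_comp]
  apply CartesianMonoidalCategory.hom_ext
  · rw [Category.assoc, lift_fst, e1]
    simp [← Functor.map_comp]
  · rw [Category.assoc, lift_snd, e2]
    simp [← Functor.map_comp]

theorem tensor_lift (h : IsCartesianMonoidal P) {A A' C C' : B} {x x' y y' : X} {f : A ⟶ A'} {g : C ⟶ C'} {φ : x ⟶ x'}
    {ψ : y ⟶ y'} (hφ : P.IsHomLift f φ) (hψ : P.IsHomLift g ψ) :
    P.IsHomLift (f ⊗ₘ g) (φ ⊗ₘ ψ) := by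
  have e : φ ⊗ₘ ψ = lift (fst x y ≫ φ) (snd x y ≫ ψ) := by
    apply CartesianMonoidalCategory.hom_ext <;> simp
  have e' : f ⊗ₘ g = lift (fst A C ≫ f) (snd A C ≫ g) := by
    apply CartesianMonoidalCategory.hom_ext <;> simp
  rw [e, e']
  exact h.lift_lift
    (homLift_comp (h.fst_lift' (IsHomLift.domain_eq P f φ) (IsHomLift.domain_eq P g ψ)) hφ)
    (homLift_comp (h.snd_lift' (IsHomLift.domain_eq P f φ) (IsHomLift.domain_eq P g ψ)) hψ)

theorem associator_lift (h : IsCartesianMonoidal P) {A C D : B} {x y z : X} (hx : P.obj x = A) (hy : P.obj y = C)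
    (hz : P.obj z = D) : P.IsHomLift (α_ A C D).hom (α_ x y z).hom := by
  have e : (α_ x y z).hom = lift (fst _ _ ≫ fst _ _) (lift (fst _ _ ≫ snd _ _) (snd _ _)) := by
    apply CartesianMonoidalCategory.hom_ext <;> simp
    apply CartesianMonoidalCategory.hom_ext <;> simp
  have e' : (α_ A C D).hom = lift (fst _ _ ≫ fst _ _) (lift (fst _ _ ≫ snd _ _) (snd _ _)) := by
    apply CartesianMonoidalCategory.hom_ext <;> simp
    apply CartesianMonoidalCategory.hom_ext <;> simp
  rw [e, e']
  have hxy := h.obj_tensor hx hy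
  exact h.lift_lift (homLift_comp (h.fst_lift' hxy hz) (h.fst_lift' hx hy))
    (h.lift_lift (homLift_comp (h.fst_lift' hxy hz) (h.snd_lift' hx hy)) (h.snd_lift' hxy hz))

theorem associator_cocart (h : IsCartesianMonoidal P) {A C D : B} {x y z : X} (hx : P.obj x = A) (hy : P.obj y = C)
    (hz : P.obj z = D) : P.IsStronglyCocartesian (α_ A C D).hom (α_ x y z).hom := by
  have := h.associator_lift hx hy hz
  infer_instance

theorem leftUnitor_cocart (h : IsCartesianMonoidal P) {A : B} {x : X} (hx : P.obj x = A) :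
    P.IsStronglyCocartesian (λ_ A).hom (λ_ x).hom := by
  have : P.IsHomLift (λ_ A).hom (λ_ x).hom := by
    rw [leftUnitor_hom, leftUnitor_hom]
    exact h.snd_lift' h.obj_unit hx
  infer_instance

theorem rightUnitor_cocart (h : IsCartesianMonoidal P) {A : B} {x : X} (hx : P.obj x = A) :
    P.IsStronglyCocartesian (ρ_ A).hom (ρ_ x).hom := by
  have : P.IsHomLift (ρ_ A).hom (ρ_ x).hom := by
    rw [rightUnitor_hom, rightUnitor_hom]
    exact h.fst_lift' hx h.obj_unit
  infer_instance

end IsCartesianMonoidal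

namespace Cleavage

variable (c : Cleavage P)

/-- The terminal object of `X`, in the fibre over the terminal object of `B`. -/
def unitObj (h : IsCartesianMonoidal P) : P.Fiber (𝟙_ B) := ⟨𝟙_ X, h.obj_unit⟩

/-- The product in `X` of two objects in the fibres over `A` and `C`, in the fibre over `A × C`. -/
def prodObj (h : IsCartesianMonoidal P) {A C : B} (x : P.Fiber A) (y : P.Fiber C) :
    P.Fiber (A ⊗ C) :=
  ⟨x.1 ⊗ y.1, h.obj_tensor x.2 y.2⟩

/-- The product of two vertical arrows. -/
def prodMap (h : IsCartesianMonoidal P) {A C : B} {x x' : P.Fiber A} {y y' : P.Fiber C}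
    (k : x ⟶ x') (l : y ⟶ y') : prodObj h x y ⟶ prodObj h x' y' :=
  ⟨k.1 ⊗ₘ l.1, by
    have := h.tensor_lift k.2 l.2
    rwa [id_tensorHom_id] at this⟩

/-- `L^{A,C} = ⟨π₁_*, π₂_*⟩ : F(A × C) ⥤ F(A) × F(C)`. -/
noncomputable def L (A C : B) : P.Fiber (A ⊗ C) ⥤ P.Fiber A × P.Fiber C :=
  (c.pushFunctor (fst A C)).prod' (c.pushFunctor (snd A C))

/-- `R^{A,C} : F(A) × F(C) ⥤ F(A × C)`, the product in `X`. -/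
def R (h : IsCartesianMonoidal P) (A C : B) : P.Fiber A × P.Fiber C ⥤ P.Fiber (A ⊗ C) where
  obj p := prodObj h p.1 p.2
  map k := prodMap h k.1 k.2
  map_id _ := Subtype.ext (id_tensorHom_id _ _)
  map_comp k l := Subtype.ext (tensorHom_comp_tensorHom k.1.1 k.2.1 l.1.1 l.2.1).symm

/-- The unit component `⟨π̂₁, π̂₂⟩ : z ⟶ π₁_* z × π₂_* z`. -/
noncomputable def unitLR (h : IsCartesianMonoidal P) {A C : B} (z : P.Fiber (A ⊗ C)) :
    z ⟶ prodObj h (c.push (fst A C) z) (c.push (snd A C) z) :=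
  ⟨CartesianMonoidalCategory.lift (c.hat (fst A C) z) (c.hat (snd A C) z), by
    have := h.lift_lift (c.hat_lift (fst A C) z) (c.hat_lift (snd A C) z)
    rwa [lift_fst_snd] at this⟩

noncomputable def counitLR₁ (h : IsCartesianMonoidal P) {A C : B} (x : P.Fiber A)
    (y : P.Fiber C) : c.push (fst A C) (prodObj h x y) ⟶ x :=
  desc _ (c.hat (fst A C) (prodObj h x y)) (c.cocart _ _) (fst x.1 y.1) (h.fst_lift' x.2 y.2)

noncomputable def counitLR₂ (h : IsCartesianMonoidal P) {A C : B} (x : P.Fiber A)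
    (y : P.Fiber C) : c.push (snd A C) (prodObj h x y) ⟶ y :=
  desc _ (c.hat (snd A C) (prodObj h x y)) (c.cocart _ _) (snd x.1 y.1) (h.snd_lift' x.2 y.2)

@[simp] theorem hat_counitLR₁ (h : IsCartesianMonoidal P) {A C : B} (x : P.Fiber A)
    (y : P.Fiber C) : c.hat (fst A C) (prodObj h x y) ≫ (c.counitLR₁ h x y).1 = fst x.1 y.1 :=
  fac _ _ (c.cocart _ _) _ _

@[simp] theorem hat_counitLR₂ (h : IsCartesianMonoidal P) {A C : B} (x : P.Fiber A)
    (y : P.Fiber C) : c.hat (snd A C) (prodObj h x y) ≫ (c.counitLR₂ h x y).1 = snd x.1 y.1 :=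
  fac _ _ (c.cocart _ _) _ _

/-- The adjunction `L^{A,C} ⊣ R^{A,C}`. -/
noncomputable def adj (h : IsCartesianMonoidal P) (A C : B) : c.L A C ⊣ R h A C :=
  Adjunction.mkOfUnitCounit
    { unit :=
        { app z := c.unitLR h z
          naturality z w k := Subtype.ext (by
            change k.1 ≫ lift (c.hat (fst A C) w) (c.hat (snd A C) w) =
              lift (c.hat (fst A C) z) (c.hat (snd A C) z) ≫
                ((c.pushMap _ k).1 ⊗ₘ (c.pushMap _ k).1)
            simp [lift_map, comp_lift]) }
      counit :=
        { app p := (c.counitLR₁ h p.1 p.2, c.counitLR₂ h p.1 p.2)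
          naturality p q k := by
            refine Prod.ext ?_ ?_
            · refine vert_ext _ _ (c.cocart (fst A C) (prodObj h p.1 p.2)) ?_
              change c.hat _ (prodObj h p.1 p.2) ≫ (c.pushMap _ (prodMap h k.1 k.2)).1 ≫
                (c.counitLR₁ h q.1 q.2).1 =
                c.hat _ (prodObj h p.1 p.2) ≫ (c.counitLR₁ h p.1 p.2).1 ≫ k.1.1
              rw [hat_pushMap_assoc, hat_counitLR₁, ← Category.assoc, hat_counitLR₁]
              exact tensorHom_fst _ _
            · refine vert_ext _ _ (c.cocart (snd A C) (prodObj h p.1 p.2)) ?_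
              change c.hat _ (prodObj h p.1 p.2) ≫ (c.pushMap _ (prodMap h k.1 k.2)).1 ≫
                (c.counitLR₂ h q.1 q.2).1 =
                c.hat _ (prodObj h p.1 p.2) ≫ (c.counitLR₂ h p.1 p.2).1 ≫ k.2.1
              rw [hat_pushMap_assoc, hat_counitLR₂, ← Category.assoc, hat_counitLR₂]
              exact tensorHom_snd _ _ }
      left_triangle := by
        refine NatTrans.ext (funext fun (z : P.Fiber (A ⊗ C)) => Prod.ext ?_ ?_)
        · refine vert_ext _ _ (c.cocart (fst A C) z) ?_
          change c.hat _ z ≫ (c.pushMap _ (c.unitLR h z)).1 ≫ 𝟙 _ ≫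
            (c.counitLR₁ h (c.push _ z) (c.push _ z)).1 = c.hat _ z ≫ 𝟙 _
          rw [Category.id_comp, hat_pushMap_assoc, hat_counitLR₁]
          exact (lift_fst _ _).trans (Category.comp_id _).symm
        · refine vert_ext _ _ (c.cocart (snd A C) z) ?_
          change c.hat _ z ≫ (c.pushMap _ (c.unitLR h z)).1 ≫ 𝟙 _ ≫
            (c.counitLR₂ h (c.push _ z) (c.push _ z)).1 = c.hat _ z ≫ 𝟙 _
          rw [Category.id_comp, hat_pushMap_assoc, hat_counitLR₂]
          exact (lift_snd _ _).trans (Category.comp_id _).symm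
      right_triangle := by
        refine NatTrans.ext (funext fun (p : P.Fiber A × P.Fiber C) => Subtype.ext ?_)
        change lift (c.hat (fst A C) (prodObj h p.1 p.2)) (c.hat (snd A C) (prodObj h p.1 p.2)) ≫
          𝟙 _ ≫ ((c.counitLR₁ h p.1 p.2).1 ⊗ₘ (c.counitLR₂ h p.1 p.2).1) = 𝟙 (p.1.1 ⊗ p.2.1)
        rw [Category.id_comp, lift_map, hat_counitLR₁, hat_counitLR₂]
        exact lift_fst_snd }

/-- `L¹ : F(I) ⥤ 𝟏`, the unique functor to the terminal category. -/
def L₁ (P : X ⥤ B) : P.Fiber (𝟙_ B) ⥤ Discrete PUnit.{1} := Functor.star _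

/-- `R¹ : 𝟏 ⥤ F(I)`, the terminal object of `X`. -/
def R₁ (h : IsCartesianMonoidal P) : Discrete PUnit.{1} ⥤ P.Fiber (𝟙_ B) :=
  Functor.fromPUnit (unitObj h)

/-- The adjunction `L¹ ⊣ R¹`. -/
def adj₁ (h : IsCartesianMonoidal P) : L₁ P ⊣ R₁ h :=
  Adjunction.mkOfUnitCounit
    { unit :=
        { app z := ⟨toUnit z.1, by
            obtain ⟨z, hz⟩ := z
            have e := IsHomLift.of_commsq P (𝟙 (𝟙_ B)) (toUnit z) hz h.obj_unit (toUnit_unique _ _)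
            exact e⟩
          naturality _ _ _ := Subtype.ext (toUnit_unique _ _) }
      counit := { app _ := Discrete.eqToHom rfl }
      right_triangle := by
        refine NatTrans.ext (funext fun _ => Subtype.ext (toUnit_unique _ _)) }

section FibreMonoidal

open MonObj

variable (h : IsCartesianMonoidal P) (M : B) [MonObj M]

/-- The tensor product on objects of `F(M)`: `x ⊗ y = m_* (x × y)`. -/
noncomputable def tens (x y : P.Fiber M) : P.Fiber M := c.push μ[M] (prodObj h x y)

/-- The cocartesian lifting `x × y ⟶ x ⊗ y` of the multiplication. -/
noncomputable def kap (x y : P.Fiber M) : x.1 ⊗ y.1 ⟶ (c.tens h M x y).1 :=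
  c.hat μ[M] (prodObj h x y)

/-- The unit object `e_* (I)` of `F(M)`. -/
noncomputable def unit : P.Fiber M := c.push η[M] (unitObj h)

/-- The cocartesian lifting `I ⟶ e_* (I)` of the unit. -/
noncomputable def eps : 𝟙_ X ⟶ (c.unit h M).1 := c.hat η[M] (unitObj h)

theorem kap_cocart (x y : P.Fiber M) : P.IsStronglyCocartesian μ[M] (c.kap h M x y) :=
  c.cocart μ[M] (prodObj h x y)

theorem eps_cocart : P.IsStronglyCocartesian η[M] (c.eps h M) := c.cocart η[M] (unitObj h)

variable {M}

/-- The tensor product on arrows of `F(M)`: `k ⊗ l = m_* (k × l)`. -/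
noncomputable def tensMap {x x' y y' : P.Fiber M} (k : x ⟶ x') (l : y ⟶ y') :
    c.tens h M x y ⟶ c.tens h M x' y' :=
  c.pushMap μ[M] (prodMap h k l)

@[simp] theorem kap_tensMap {x x' y y' : P.Fiber M} (k : x ⟶ x') (l : y ⟶ y') :
    c.kap h M x y ≫ (c.tensMap h k l).1 = (k.1 ⊗ₘ l.1) ≫ c.kap h M x' y' :=
  c.hat_pushMap μ[M] (prodMap h k l)

@[simp] theorem kap_tensMap_assoc {x x' y y' : P.Fiber M} (k : x ⟶ x') (l : y ⟶ y') {t : X}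
    (r : (c.tens h M x' y').1 ⟶ t) :
    c.kap h M x y ≫ (c.tensMap h k l).1 ≫ r = (k.1 ⊗ₘ l.1) ≫ c.kap h M x' y' ≫ r := by
  have := congrArg (· ≫ r) (c.kap_tensMap h k l)
  simpa only [Category.assoc] using this

/-- The cocartesian arrow `(x × y) × z ⟶ (x ⊗ y) ⊗ z`. -/
noncomputable def kapL (x y z : P.Fiber M) :
    (x.1 ⊗ y.1) ⊗ z.1 ⟶ (c.tens h M (c.tens h M x y) z).1 :=
  (c.kap h M x y ⊗ₘ 𝟙 z.1) ≫ c.kap h M (c.tens h M x y) z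

/-- The cocartesian arrow `(x × y) × z ≅ x × (y × z) ⟶ x ⊗ (y ⊗ z)`. -/
noncomputable def kapR (x y z : P.Fiber M) :
    (x.1 ⊗ y.1) ⊗ z.1 ⟶ (c.tens h M x (c.tens h M y z)).1 :=
  (α_ x.1 y.1 z.1).hom ≫ (𝟙 x.1 ⊗ₘ c.kap h M y z) ≫ c.kap h M x (c.tens h M y z)

theorem kapL_cocart (x y z : P.Fiber M) :
    P.IsStronglyCocartesian ((μ[M] ⊗ₘ 𝟙 M) ≫ μ[M]) (c.kapL h x y z) :=
  cocart_comp (h.tensor_cocart (c.kap_cocart h M x y) (cocart_id z)) (c.kap_cocart h M _ z)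

theorem kapR_cocart (x y z : P.Fiber M) :
    P.IsStronglyCocartesian ((μ[M] ⊗ₘ 𝟙 M) ≫ μ[M]) (c.kapR h x y z) := by
  have e : (μ[M] ⊗ₘ 𝟙 M) ≫ μ[M] = (α_ M M M).hom ≫ (𝟙 M ⊗ₘ μ[M]) ≫ μ[M] := by
    simp
  rw [e]
  exact cocart_comp (h.associator_cocart x.2 y.2 z.2)
    (cocart_comp (h.tensor_cocart (cocart_id x) (c.kap_cocart h M y z)) (c.kap_cocart h M x _))

/-- The associativity constraint: the unique vertical arrow compatible with the associator of the
products in `X` and the cocartesian liftings of the two composite multiplications. -/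
noncomputable def tensAssoc (x y z : P.Fiber M) :
    c.tens h M (c.tens h M x y) z ≅ c.tens h M x (c.tens h M y z) :=
  descIso _ (c.kapL h x y z) (c.kapL_cocart h x y z) (c.kapR h x y z) (c.kapR_cocart h x y z)

theorem kapL_tensAssoc (x y z : P.Fiber M) :
    c.kapL h x y z ≫ (c.tensAssoc h x y z).hom.1 = c.kapR h x y z :=
  fac _ _ (c.kapL_cocart h x y z) _ _

@[simp] theorem kap_tensAssoc (x y z : P.Fiber M) :
    (c.kap h M x y ⊗ₘ 𝟙 z.1) ≫ c.kap h M (c.tens h M x y) z ≫ (c.tensAssoc h x y z).hom.1 =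
      (α_ x.1 y.1 z.1).hom ≫ (𝟙 x.1 ⊗ₘ c.kap h M y z) ≫ c.kap h M x (c.tens h M y z) := by
  have := c.kapL_tensAssoc h x y z
  simpa only [kapL, kapR, Category.assoc] using this

@[simp] theorem kap_tensAssoc_assoc (x y z : P.Fiber M) {t : X}
    (r : (c.tens h M x (c.tens h M y z)).1 ⟶ t) :
    (c.kap h M x y ⊗ₘ 𝟙 z.1) ≫ c.kap h M (c.tens h M x y) z ≫
      (c.tensAssoc h x y z).hom.1 ≫ r =
      (α_ x.1 y.1 z.1).hom ≫ (𝟙 x.1 ⊗ₘ c.kap h M y z) ≫ c.kap h M x (c.tens h M y z) ≫ r := by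
  have := congrArg (· ≫ r) (c.kap_tensAssoc h x y z)
  simpa only [Category.assoc] using this

theorem unitL_cocart (x : P.Fiber M) : P.IsStronglyCocartesian ((η[M] ⊗ₘ 𝟙 M) ≫ μ[M])
    ((c.eps h M ⊗ₘ 𝟙 x.1) ≫ c.kap h M (c.unit h M) x) :=
  cocart_comp (h.tensor_cocart (c.eps_cocart h M) (cocart_id x)) (c.kap_cocart h M _ x)

theorem unitR_cocart (x : P.Fiber M) : P.IsStronglyCocartesian ((𝟙 M ⊗ₘ η[M]) ≫ μ[M])
    ((𝟙 x.1 ⊗ₘ c.eps h M) ≫ c.kap h M x (c.unit h M)) :=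
  cocart_comp (h.tensor_cocart (cocart_id x) (c.eps_cocart h M)) (c.kap_cocart h M x _)

/-- The left unit constraint, induced by `I × x ≅ x`. -/
noncomputable def tensLeft (x : P.Fiber M) : c.tens h M (c.unit h M) x ≅ x :=
  descIso ((η[M] ⊗ₘ 𝟙 M) ≫ μ[M]) ((c.eps h M ⊗ₘ 𝟙 x.1) ≫ c.kap h M (c.unit h M) x)
    (c.unitL_cocart h x) (λ_ x.1).hom (by simpa using h.leftUnitor_cocart x.2)

/-- The right unit constraint, induced by `x × I ≅ x`. -/
noncomputable def tensRight (x : P.Fiber M) : c.tens h M x (c.unit h M) ≅ x :=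
  descIso ((𝟙 M ⊗ₘ η[M]) ≫ μ[M]) ((𝟙 x.1 ⊗ₘ c.eps h M) ≫ c.kap h M x (c.unit h M))
    (c.unitR_cocart h x) (ρ_ x.1).hom (by simpa using h.rightUnitor_cocart x.2)

@[simp] theorem kap_tensLeft (x : P.Fiber M) : (c.eps h M ⊗ₘ 𝟙 x.1) ≫
    c.kap h M (c.unit h M) x ≫ (c.tensLeft h x).hom.1 = (λ_ x.1).hom := by
  have := fac _ _ (c.unitL_cocart h x) (λ_ x.1).hom
    (by simpa using (h.leftUnitor_cocart x.2).toIsHomLift)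
  rw [Category.assoc] at this
  exact this

@[simp] theorem kap_tensRight (x : P.Fiber M) : (𝟙 x.1 ⊗ₘ c.eps h M) ≫
    c.kap h M x (c.unit h M) ≫ (c.tensRight h x).hom.1 = (ρ_ x.1).hom := by
  have := fac _ _ (c.unitR_cocart h x) (ρ_ x.1).hom
    (by simpa using (h.rightUnitor_cocart x.2).toIsHomLift)
  rw [Category.assoc] at this
  exact this

theorem tensMap_id (x y : P.Fiber M) : c.tensMap h (𝟙 x) (𝟙 y) = 𝟙 (c.tens h M x y) :=
  vert_ext _ _ (c.kap_cocart h M x y) (by simp)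

theorem tensMap_comp {x x' x'' y y' y'' : P.Fiber M} (k : x ⟶ x') (l : y ⟶ y')
    (k' : x' ⟶ x'') (l' : y' ⟶ y'') :
    c.tensMap h k l ≫ c.tensMap h k' l' = c.tensMap h (k ≫ k') (l ≫ l') :=
  vert_ext _ _ (c.kap_cocart h M x y) (by
    rw [comp_val, kap_tensMap_assoc, kap_tensMap, kap_tensMap, ← Category.assoc,
      tensorHom_comp_tensorHom, comp_val, comp_val])

theorem tensAssoc_naturality {x x' y y' z z' : P.Fiber M} (k : x ⟶ x') (l : y ⟶ y')
    (r : z ⟶ z') :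
    c.tensMap h (c.tensMap h k l) r ≫ (c.tensAssoc h x' y' z').hom =
      (c.tensAssoc h x y z).hom ≫ c.tensMap h k (c.tensMap h l r) := by
  refine vert_ext _ _ (c.kapL_cocart h x y z) ?_
  rw [comp_val, comp_val, ← Category.assoc (c.kapL h x y z) (c.tensAssoc h x y z).hom.1,
    kapL_tensAssoc, kapL, kapR]
  have e1 : (c.kap h M x y ⊗ₘ 𝟙 z.1) ≫ ((c.tensMap h k l).1 ⊗ₘ r.1) =
      ((k.1 ⊗ₘ l.1) ⊗ₘ r.1) ≫ (c.kap h M x' y' ⊗ₘ 𝟙 z'.1) := by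
    rw [tensorHom_comp_tensorHom, tensorHom_comp_tensorHom, kap_tensMap, Category.id_comp,
      Category.comp_id]
  have e2 : (𝟙 x.1 ⊗ₘ c.kap h M y z) ≫ (k.1 ⊗ₘ (c.tensMap h l r).1) =
      (k.1 ⊗ₘ (l.1 ⊗ₘ r.1)) ≫ (𝟙 x'.1 ⊗ₘ c.kap h M y' z') := by
    rw [tensorHom_comp_tensorHom, tensorHom_comp_tensorHom, kap_tensMap, Category.id_comp,
      Category.comp_id]
  simp only [Category.assoc]
  rw [kap_tensMap_assoc, ← Category.assoc, e1, Category.assoc, kap_tensAssoc, kap_tensMap,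
    ← Category.assoc (𝟙 x.1 ⊗ₘ c.kap h M y z), e2, Category.assoc, ← Category.assoc,
    ← Category.assoc (α_ x.1 y.1 z.1).hom, associator_naturality]

theorem tensLeft_naturality {x y : P.Fiber M} (k : x ⟶ y) :
    c.tensMap h (𝟙 (c.unit h M)) k ≫ (c.tensLeft h y).hom = (c.tensLeft h x).hom ≫ k := by
  refine vert_ext _ _ (c.unitL_cocart h x) ?_
  have e : (c.eps h M ⊗ₘ 𝟙 x.1) ≫ (𝟙 (c.unit h M).1 ⊗ₘ k.1) =
      (𝟙 (𝟙_ X) ⊗ₘ k.1) ≫ (c.eps h M ⊗ₘ 𝟙 y.1) := by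
    simp only [tensorHom_comp_tensorHom, Category.id_comp, Category.comp_id]
  have e' := congrArg (· ≫ k.1) (c.kap_tensLeft h x)
  simp only [Category.assoc] at e'
  simp only [comp_val, id_val, Category.assoc, kap_tensMap_assoc]
  rw [← Category.assoc, e, Category.assoc, kap_tensLeft, e']
  simp

theorem tensRight_naturality {x y : P.Fiber M} (k : x ⟶ y) :
    c.tensMap h k (𝟙 (c.unit h M)) ≫ (c.tensRight h y).hom = (c.tensRight h x).hom ≫ k := by
  refine vert_ext _ _ (c.unitR_cocart h x) ?_
  have e : (𝟙 x.1 ⊗ₘ c.eps h M) ≫ (k.1 ⊗ₘ 𝟙 (c.unit h M).1) =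
      (k.1 ⊗ₘ 𝟙 (𝟙_ X)) ≫ (𝟙 y.1 ⊗ₘ c.eps h M) := by
    simp only [tensorHom_comp_tensorHom, Category.id_comp, Category.comp_id]
  have e' := congrArg (· ≫ k.1) (c.kap_tensRight h x)
  simp only [Category.assoc] at e'
  simp only [comp_val, id_val, Category.assoc, kap_tensMap_assoc]
  rw [← Category.assoc, e, Category.assoc, kap_tensRight, e']
  simp

theorem tens_pentagon (w x y z : P.Fiber M) :
    (c.tensMap h (c.tensAssoc h w x y).hom (𝟙 z)) ≫ (c.tensAssoc h w (c.tens h M x y) z).hom ≫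
      c.tensMap h (𝟙 w) (c.tensAssoc h x y z).hom =
    (c.tensAssoc h (c.tens h M w x) y z).hom ≫ (c.tensAssoc h w x (c.tens h M y z)).hom := by
  refine vert_ext _ _ (cocart_comp (h.tensor_cocart (c.kapL_cocart h w x y) (cocart_id z))
    (c.kap_cocart h M _ z)) ?_
  have e1 : (c.kapL h w x y ⊗ₘ 𝟙 z.1) ≫ ((c.tensAssoc h w x y).hom.1 ⊗ₘ 𝟙 z.1) =
      ((α_ w.1 x.1 y.1).hom ⊗ₘ 𝟙 z.1) ≫ ((𝟙 w.1 ⊗ₘ c.kap h M x y) ⊗ₘ 𝟙 z.1) ≫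
        (c.kap h M w (c.tens h M x y) ⊗ₘ 𝟙 z.1) := by
    simp only [tensorHom_comp_tensorHom, kapL_tensAssoc, Category.id_comp, kapR]
  have e2 : (𝟙 w.1 ⊗ₘ (c.kap h M x y ⊗ₘ 𝟙 z.1)) ≫ (𝟙 w.1 ⊗ₘ c.kap h M (c.tens h M x y) z) ≫
      (𝟙 w.1 ⊗ₘ (c.tensAssoc h x y z).hom.1) = (𝟙 w.1 ⊗ₘ (α_ x.1 y.1 z.1).hom) ≫
      (𝟙 w.1 ⊗ₘ (𝟙 x.1 ⊗ₘ c.kap h M y z)) ≫ (𝟙 w.1 ⊗ₘ c.kap h M x (c.tens h M y z)) := by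
    simp only [tensorHom_comp_tensorHom, kap_tensAssoc, Category.id_comp]
  have e3 : (c.kapL h w x y ⊗ₘ 𝟙 z.1) = ((c.kap h M w x ⊗ₘ 𝟙 y.1) ⊗ₘ 𝟙 z.1) ≫
      (c.kap h M (c.tens h M w x) y ⊗ₘ 𝟙 z.1) := by
    simp only [tensorHom_comp_tensorHom, Category.id_comp, kapL]
  have e4 : (c.kap h M w x ⊗ₘ (𝟙 y.1 ⊗ₘ 𝟙 z.1)) ≫ (𝟙 (c.tens h M w x).1 ⊗ₘ c.kap h M y z) =
      (𝟙 (w.1 ⊗ x.1) ⊗ₘ c.kap h M y z) ≫ (c.kap h M w x ⊗ₘ 𝟙 (c.tens h M y z).1) := by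
    simp only [tensorHom_comp_tensorHom, id_tensorHom_id, Category.id_comp, Category.comp_id]
  calc
    _ = ((c.kapL h w x y ⊗ₘ 𝟙 z.1) ≫ ((c.tensAssoc h w x y).hom.1 ⊗ₘ 𝟙 z.1)) ≫
          c.kap h M (c.tens h M w (c.tens h M x y)) z ≫
            (c.tensAssoc h w (c.tens h M x y) z).hom.1 ≫
              (c.tensMap h (𝟙 w) (c.tensAssoc h x y z).hom).1 := by
        simp only [comp_val, Category.assoc, kap_tensMap_assoc, id_val]
    _ = ((α_ w.1 x.1 y.1).hom ⊗ₘ 𝟙 z.1) ≫ (((𝟙 w.1 ⊗ₘ c.kap h M x y) ⊗ₘ 𝟙 z.1) ≫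
          (α_ _ _ _).hom) ≫ (𝟙 w.1 ⊗ₘ c.kap h M (c.tens h M x y) z) ≫
            (𝟙 w.1 ⊗ₘ (c.tensAssoc h x y z).hom.1) ≫
              c.kap h M w (c.tens h M x (c.tens h M y z)) := by
        rw [e1]
        simp only [Category.assoc, kap_tensAssoc_assoc, kap_tensMap, id_val]
    _ = ((α_ w.1 x.1 y.1).hom ⊗ₘ 𝟙 z.1) ≫ (α_ _ _ _).hom ≫
          ((𝟙 w.1 ⊗ₘ (c.kap h M x y ⊗ₘ 𝟙 z.1)) ≫ (𝟙 w.1 ⊗ₘ c.kap h M (c.tens h M x y) z) ≫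
            (𝟙 w.1 ⊗ₘ (c.tensAssoc h x y z).hom.1)) ≫
              c.kap h M w (c.tens h M x (c.tens h M y z)) := by
        rw [associator_naturality]
        simp only [Category.assoc]
    _ = (((α_ w.1 x.1 y.1).hom ⊗ₘ 𝟙 z.1) ≫ (α_ _ _ _).hom ≫ (𝟙 w.1 ⊗ₘ (α_ x.1 y.1 z.1).hom)) ≫
          (𝟙 w.1 ⊗ₘ (𝟙 x.1 ⊗ₘ c.kap h M y z)) ≫ (𝟙 w.1 ⊗ₘ c.kap h M x (c.tens h M y z)) ≫
              c.kap h M w (c.tens h M x (c.tens h M y z)) := by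
        rw [e2]
        simp only [Category.assoc]
    _ = ((α_ (w.1 ⊗ x.1) y.1 z.1).hom ≫ (α_ w.1 x.1 (y.1 ⊗ z.1)).hom) ≫
          (𝟙 w.1 ⊗ₘ (𝟙 x.1 ⊗ₘ c.kap h M y z)) ≫ (𝟙 w.1 ⊗ₘ c.kap h M x (c.tens h M y z)) ≫
              c.kap h M w (c.tens h M x (c.tens h M y z)) := by
        rw [tensorHom_id, id_tensorHom, pentagon]
    _ = (α_ (w.1 ⊗ x.1) y.1 z.1).hom ≫ ((𝟙 (w.1 ⊗ x.1) ⊗ₘ c.kap h M y z) ≫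
          (c.kap h M w x ⊗ₘ 𝟙 (c.tens h M y z).1)) ≫ c.kap h M (c.tens h M w x) (c.tens h M y z) ≫
            (c.tensAssoc h w x (c.tens h M y z)).hom.1 := by
        simp only [Category.assoc, kap_tensAssoc]
        rw [← id_tensorHom_id, ← Category.assoc ((𝟙 w.1 ⊗ₘ 𝟙 x.1) ⊗ₘ c.kap h M y z),
          associator_naturality, Category.assoc]
    _ = (((c.kap h M w x ⊗ₘ 𝟙 y.1) ⊗ₘ 𝟙 z.1) ≫ (α_ _ y.1 z.1).hom) ≫
          (𝟙 (c.tens h M w x).1 ⊗ₘ c.kap h M y z) ≫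
            c.kap h M (c.tens h M w x) (c.tens h M y z) ≫
            (c.tensAssoc h w x (c.tens h M y z)).hom.1 := by
        rw [← e4, associator_naturality]
        simp only [Category.assoc]
    _ = _ := by
        rw [e3]
        simp only [comp_val, Category.assoc, kap_tensAssoc_assoc]

theorem tens_triangle (x y : P.Fiber M) :
    (c.tensAssoc h x (c.unit h M) y).hom ≫ c.tensMap h (𝟙 x) (c.tensLeft h y).hom =
      c.tensMap h (c.tensRight h x).hom (𝟙 y) := by
  refine vert_ext _ (((𝟙 x.1 ⊗ₘ c.eps h M) ⊗ₘ 𝟙 y.1) ≫ c.kapL h x (c.unit h M) y)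
    (cocart_comp (h.tensor_cocart (h.tensor_cocart (cocart_id x) (c.eps_cocart h M))
      (cocart_id y)) (c.kapL_cocart h x _ y)) ?_
  have e1 : ((𝟙 x.1 ⊗ₘ c.eps h M) ⊗ₘ 𝟙 y.1) ≫ (c.kap h M x (c.unit h M) ⊗ₘ 𝟙 y.1) ≫
      ((c.tensRight h x).hom.1 ⊗ₘ 𝟙 y.1) = ((ρ_ x.1).hom ⊗ₘ 𝟙 y.1) := by
    simp only [tensorHom_comp_tensorHom, kap_tensRight, Category.id_comp]
  have e2 : (𝟙 x.1 ⊗ₘ (c.eps h M ⊗ₘ 𝟙 y.1)) ≫ (𝟙 x.1 ⊗ₘ c.kap h M (c.unit h M) y) ≫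
      (𝟙 x.1 ⊗ₘ (c.tensLeft h y).hom.1) = (𝟙 x.1 ⊗ₘ (λ_ y.1).hom) := by
    simp only [tensorHom_comp_tensorHom, kap_tensLeft, Category.id_comp]
  calc
    _ = (((𝟙 x.1 ⊗ₘ c.eps h M) ⊗ₘ 𝟙 y.1) ≫ (α_ _ _ _).hom) ≫
        (𝟙 x.1 ⊗ₘ c.kap h M (c.unit h M) y) ≫ (𝟙 x.1 ⊗ₘ (c.tensLeft h y).hom.1) ≫
          c.kap h M x y := by
        simp only [comp_val, kapL, Category.assoc, kap_tensAssoc_assoc, kap_tensMap, id_val]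
    _ = (α_ _ _ _).hom ≫ ((𝟙 x.1 ⊗ₘ (c.eps h M ⊗ₘ 𝟙 y.1)) ≫
        (𝟙 x.1 ⊗ₘ c.kap h M (c.unit h M) y) ≫ (𝟙 x.1 ⊗ₘ (c.tensLeft h y).hom.1)) ≫
          c.kap h M x y := by
        rw [associator_naturality]
        simp only [Category.assoc]
    _ = ((ρ_ x.1).hom ⊗ₘ 𝟙 y.1) ≫ c.kap h M x y := by
        rw [e2, ← Category.assoc, id_tensorHom, tensorHom_id, triangle]
    _ = _ := by
        rw [← e1]
        simp only [kapL, Category.assoc, kap_tensMap, id_val]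

variable (M)

/-- The monoidal category `F(M)` associated with a monoid `M` of `B` by the lax monoidal structure
`(R, R¹)` of `F`: the tensor product is `F(m) ∘ R^{M,M}` and the unit is `F(e) ∘ R¹`. -/
@[reducible]
noncomputable def fibreMonoidal : MonoidalCategory (P.Fiber M) where
  tensorObj x y := c.tens h M x y
  tensorHom k l := c.tensMap h k l
  whiskerLeft x _ _ k := c.tensMap h (𝟙 x) k
  whiskerRight k y := c.tensMap h k (𝟙 y)
  tensorUnit := c.unit h M
  associator x y z := c.tensAssoc h x y z
  leftUnitor x := c.tensLeft h x
  rightUnitor x := c.tensRight h x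
  tensorHom_def k l := by
    rw [tensMap_comp, Category.id_comp, Category.comp_id]
  id_tensorHom_id x y := c.tensMap_id h x y
  tensorHom_comp_tensorHom k l k' l' := c.tensMap_comp h k l k' l'
  whiskerLeft_id x y := c.tensMap_id h x y
  id_whiskerRight x y := c.tensMap_id h x y
  associator_naturality k l r := c.tensAssoc_naturality h k l r
  leftUnitor_naturality k := c.tensLeft_naturality h k
  rightUnitor_naturality k := c.tensRight_naturality h k
  pentagon w x y z := c.tens_pentagon h w x y z
  triangle x y := c.tens_triangle h x y

/-- The tensor product of `F(M)` is `F(m) ∘ R^{M,M}`. -/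
theorem fibreMonoidal_tensor (x y : P.Fiber M) :
    (c.fibreMonoidal h M).tensorObj x y =
      (c.pushFunctor μ[M]).obj ((R h M M).obj (x, y)) := rfl

/-- The unit of `F(M)` is `F(e) ∘ R¹`. -/
theorem fibreMonoidal_unit : (c.fibreMonoidal h M).tensorUnit =
      (c.pushFunctor η[M]).obj ((R₁ h).obj ⟨⟨⟩⟩) := rfl

section MonHom

variable {M} {N : B} [MonObj N] (f : M ⟶ N) [IsMonHom f]

theorem hatL_cocart (x y : P.Fiber M) : P.IsStronglyCocartesian ((f ⊗ₘ f) ≫ μ[N])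
    ((c.hat f x ⊗ₘ c.hat f y) ≫ c.kap h N (c.push f x) (c.push f y)) :=
  cocart_comp (h.tensor_cocart (c.cocart f x) (c.cocart f y)) (c.kap_cocart h N _ _)

theorem hatR_cocart (x y : P.Fiber M) : P.IsStronglyCocartesian ((f ⊗ₘ f) ≫ μ[N])
    (c.kap h M x y ≫ c.hat f (c.tens h M x y)) := by
  rw [← IsMonHom.mul_hom]
  exact cocart_comp (c.kap_cocart h M x y) (c.cocart f _)

/-- The comparison `f_* x ⊗ f_* y ≅ f_* (x ⊗ y)`. -/
noncomputable def pushTens (x y : P.Fiber M) :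
    c.tens h N (c.push f x) (c.push f y) ≅ c.push f (c.tens h M x y) :=
  descIso _ _ (c.hatL_cocart h f x y) _ (c.hatR_cocart h f x y)

@[simp] theorem hat_pushTens (x y : P.Fiber M) : (c.hat f x ⊗ₘ c.hat f y) ≫
    c.kap h N (c.push f x) (c.push f y) ≫ (c.pushTens h f x y).hom.1 =
      c.kap h M x y ≫ c.hat f (c.tens h M x y) := by
  rw [← Category.assoc]
  exact fac _ _ (c.hatL_cocart h f x y) _ _

@[simp] theorem hat_pushTens_assoc (x y : P.Fiber M) {t : X}
    (r : (c.push f (c.tens h M x y)).1 ⟶ t) : (c.hat f x ⊗ₘ c.hat f y) ≫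
    c.kap h N (c.push f x) (c.push f y) ≫ (c.pushTens h f x y).hom.1 ≫ r =
      c.kap h M x y ≫ c.hat f (c.tens h M x y) ≫ r := by
  have := congrArg (· ≫ r) (c.hat_pushTens h f x y)
  simpa only [Category.assoc] using this

theorem epsHat_cocart : P.IsStronglyCocartesian η[N] (c.eps h M ≫ c.hat f (c.unit h M)) := by
  rw [← IsMonHom.one_hom f]
  exact cocart_comp (c.eps_cocart h M) (c.cocart f _)

/-- The comparison `E ≅ f_* E`. -/
noncomputable def pushUnit : c.unit h N ≅ c.push f (c.unit h M) :=
  descIso _ _ (c.eps_cocart h N) _ (c.epsHat_cocart h f)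

@[simp] theorem eps_pushUnit :
    c.eps h N ≫ (c.pushUnit h f).hom.1 = c.eps h M ≫ c.hat f (c.unit h M) :=
  fac _ _ (c.eps_cocart h N) _ _

theorem pushTens_naturality {x x' y y' : P.Fiber M} (k : x ⟶ x') (l : y ⟶ y') :
    c.tensMap h (c.pushMap f k) (c.pushMap f l) ≫ (c.pushTens h f x' y').hom =
      (c.pushTens h f x y).hom ≫ c.pushMap f (c.tensMap h k l) := by
  refine vert_ext _ _ (c.hatL_cocart h f x y) ?_
  have e : (c.hat f x ⊗ₘ c.hat f y) ≫ ((c.pushMap f k).1 ⊗ₘ (c.pushMap f l).1) =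
      (k.1 ⊗ₘ l.1) ≫ (c.hat f x' ⊗ₘ c.hat f y') := by
    simp only [tensorHom_comp_tensorHom, hat_pushMap]
  simp only [comp_val, Category.assoc, kap_tensMap_assoc, hat_pushTens_assoc, hat_pushMap]
  rw [← Category.assoc, e, Category.assoc, hat_pushTens]

theorem pushTens_assoc (x y z : P.Fiber M) :
    c.tensMap h (c.pushTens h f x y).hom (𝟙 (c.push f z)) ≫
      (c.pushTens h f (c.tens h M x y) z).hom ≫ c.pushMap f (c.tensAssoc h x y z).hom =
    (c.tensAssoc h (c.push f x) (c.push f y) (c.push f z)).hom ≫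
      c.tensMap h (𝟙 (c.push f x)) (c.pushTens h f y z).hom ≫
        (c.pushTens h f x (c.tens h M y z)).hom := by
  refine vert_ext _ (((c.hat f x ⊗ₘ c.hat f y) ⊗ₘ c.hat f z) ≫ c.kapL h _ _ _)
    (cocart_comp (h.tensor_cocart (h.tensor_cocart (c.cocart f x) (c.cocart f y)) (c.cocart f z))
      (c.kapL_cocart h _ _ _)) ?_
  have e1 : ((c.hat f x ⊗ₘ c.hat f y) ⊗ₘ c.hat f z) ≫
      (c.kap h N (c.push f x) (c.push f y) ⊗ₘ 𝟙 (c.push f z).1) ≫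
        ((c.pushTens h f x y).hom.1 ⊗ₘ 𝟙 (c.push f z).1) =
      (c.kap h M x y ⊗ₘ 𝟙 z.1) ≫ (c.hat f (c.tens h M x y) ⊗ₘ c.hat f z) := by
    simp only [tensorHom_comp_tensorHom, hat_pushTens, Category.comp_id, Category.id_comp]
  have e2 : (c.hat f x ⊗ₘ (c.hat f y ⊗ₘ c.hat f z)) ≫
      (𝟙 (c.push f x).1 ⊗ₘ c.kap h N (c.push f y) (c.push f z)) ≫
        (𝟙 (c.push f x).1 ⊗ₘ (c.pushTens h f y z).hom.1) =
      (𝟙 x.1 ⊗ₘ c.kap h M y z) ≫ (c.hat f x ⊗ₘ c.hat f (c.tens h M y z)) := by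
    simp only [tensorHom_comp_tensorHom, hat_pushTens, Category.comp_id, Category.id_comp]
  calc
    _ = (((c.hat f x ⊗ₘ c.hat f y) ⊗ₘ c.hat f z) ≫
      (c.kap h N (c.push f x) (c.push f y) ⊗ₘ 𝟙 (c.push f z).1) ≫
        ((c.pushTens h f x y).hom.1 ⊗ₘ 𝟙 (c.push f z).1)) ≫ c.kap h N _ _ ≫
          (c.pushTens h f (c.tens h M x y) z).hom.1 ≫
            (c.pushMap f (c.tensAssoc h x y z).hom).1 := by
        simp only [comp_val, kapL, Category.assoc, kap_tensMap_assoc, id_val]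
    _ = (c.kap h M x y ⊗ₘ 𝟙 z.1) ≫ c.kap h M (c.tens h M x y) z ≫
          (c.tensAssoc h x y z).hom.1 ≫ c.hat f _ := by
        rw [e1]
        simp only [Category.assoc, hat_pushTens_assoc, hat_pushMap]
    _ = (α_ x.1 y.1 z.1).hom ≫ ((𝟙 x.1 ⊗ₘ c.kap h M y z) ≫
          (c.hat f x ⊗ₘ c.hat f (c.tens h M y z))) ≫ c.kap h N _ _ ≫
            (c.pushTens h f x (c.tens h M y z)).hom.1 := by
        simp only [Category.assoc, hat_pushTens, kap_tensAssoc_assoc]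
    _ = (((c.hat f x ⊗ₘ c.hat f y) ⊗ₘ c.hat f z) ≫ (α_ _ _ _).hom) ≫
          (𝟙 (c.push f x).1 ⊗ₘ c.kap h N (c.push f y) (c.push f z)) ≫
            (𝟙 (c.push f x).1 ⊗ₘ (c.pushTens h f y z).hom.1) ≫ c.kap h N _ _ ≫
              (c.pushTens h f x (c.tens h M y z)).hom.1 := by
        rw [← e2, associator_naturality]
        simp only [Category.assoc]
    _ = _ := by
        simp only [comp_val, kapL, Category.assoc, kap_tensAssoc_assoc, kap_tensMap_assoc, id_val]

theorem pushTens_left (x : P.Fiber M) :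
    (c.tensLeft h (c.push f x)).hom = c.tensMap h (c.pushUnit h f).hom (𝟙 (c.push f x)) ≫
      (c.pushTens h f (c.unit h M) x).hom ≫ c.pushMap f (c.tensLeft h x).hom := by
  refine vert_ext _ ((𝟙 (𝟙_ X) ⊗ₘ c.hat f x) ≫ (c.eps h N ⊗ₘ 𝟙 (c.push f x).1) ≫
    c.kap h N (c.unit h N) (c.push f x)) (cocart_comp (h.tensor_cocart (cocart_id (unitObj h))
      (c.cocart f x)) (c.unitL_cocart h _)) ?_
  have e : (𝟙 (𝟙_ X) ⊗ₘ c.hat f x) ≫ (c.eps h N ⊗ₘ 𝟙 (c.push f x).1) ≫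
      ((c.pushUnit h f).hom.1 ⊗ₘ 𝟙 (c.push f x).1) =
      (c.eps h M ⊗ₘ 𝟙 x.1) ≫ (c.hat f (c.unit h M) ⊗ₘ c.hat f x) := by
    simp only [tensorHom_comp_tensorHom, eps_pushUnit, Category.comp_id, Category.id_comp]
  calc
    _ = (λ_ x.1).hom ≫ c.hat f x := by
        simp only [Category.assoc, kap_tensLeft]
        rw [id_tensorHom, leftUnitor_naturality]
    _ = (c.eps h M ⊗ₘ 𝟙 x.1) ≫ c.kap h M (c.unit h M) x ≫
          (c.tensLeft h x).hom.1 ≫ c.hat f x := by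
        rw [← c.kap_tensLeft h x]
        simp only [Category.assoc]
    _ = ((c.eps h M ⊗ₘ 𝟙 x.1) ≫ (c.hat f (c.unit h M) ⊗ₘ c.hat f x)) ≫ c.kap h N _ _ ≫
          (c.pushTens h f (c.unit h M) x).hom.1 ≫ (c.pushMap f (c.tensLeft h x).hom).1 := by
        simp only [Category.assoc, hat_pushTens_assoc, hat_pushMap]
    _ = _ := by
        rw [← e]
        simp only [comp_val, Category.assoc, kap_tensMap_assoc, id_val]

theorem pushTens_right (x : P.Fiber M) :
    (c.tensRight h (c.push f x)).hom = c.tensMap h (𝟙 (c.push f x)) (c.pushUnit h f).hom ≫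
      (c.pushTens h f x (c.unit h M)).hom ≫ c.pushMap f (c.tensRight h x).hom := by
  refine vert_ext _ ((c.hat f x ⊗ₘ 𝟙 (𝟙_ X)) ≫ (𝟙 (c.push f x).1 ⊗ₘ c.eps h N) ≫
    c.kap h N (c.push f x) (c.unit h N)) (cocart_comp (h.tensor_cocart (c.cocart f x)
      (cocart_id (unitObj h))) (c.unitR_cocart h _)) ?_
  have e : (c.hat f x ⊗ₘ 𝟙 (𝟙_ X)) ≫ (𝟙 (c.push f x).1 ⊗ₘ c.eps h N) ≫
      (𝟙 (c.push f x).1 ⊗ₘ (c.pushUnit h f).hom.1) =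
      (𝟙 x.1 ⊗ₘ c.eps h M) ≫ (c.hat f x ⊗ₘ c.hat f (c.unit h M)) := by
    simp only [tensorHom_comp_tensorHom, eps_pushUnit, Category.comp_id, Category.id_comp]
  calc
    _ = (ρ_ x.1).hom ≫ c.hat f x := by
        simp only [Category.assoc, kap_tensRight]
        rw [tensorHom_id, rightUnitor_naturality]
    _ = (𝟙 x.1 ⊗ₘ c.eps h M) ≫ c.kap h M x (c.unit h M) ≫
          (c.tensRight h x).hom.1 ≫ c.hat f x := by
        rw [← c.kap_tensRight h x]
        simp only [Category.assoc]
    _ = ((𝟙 x.1 ⊗ₘ c.eps h M) ≫ (c.hat f x ⊗ₘ c.hat f (c.unit h M))) ≫ c.kap h N _ _ ≫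
          (c.pushTens h f x (c.unit h M)).hom.1 ≫ (c.pushMap f (c.tensRight h x).hom).1 := by
        simp only [Category.assoc, hat_pushTens_assoc, hat_pushMap]
    _ = _ := by
        rw [← e]
        simp only [comp_val, Category.assoc, kap_tensMap_assoc, id_val]

/-- For a morphism of monoids `f`, the functor `F(f)` is strong monoidal. -/
@[reducible]
noncomputable def pushMonoidal :
    letI := c.fibreMonoidal h M
    letI := c.fibreMonoidal h N
    (c.pushFunctor f).Monoidal :=
  letI := c.fibreMonoidal h M
  letI := c.fibreMonoidal h N
  Functor.CoreMonoidal.toMonoidal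
    { εIso := c.pushUnit h f
      μIso := c.pushTens h f
      μIso_hom_natural_left := fun {x y} k z => by
        have := c.pushTens_naturality h f k (𝟙 z)
        rwa [show c.pushMap f (𝟙 z) = 𝟙 (c.push f z) from (c.pushFunctor f).map_id z] at this
      μIso_hom_natural_right := fun {x y} z k => by
        have := c.pushTens_naturality h f (𝟙 z) k
        rwa [show c.pushMap f (𝟙 z) = 𝟙 (c.push f z) from (c.pushFunctor f).map_id z] at this
      associativity := c.pushTens_assoc h f
      left_unitality := c.pushTens_left h f
      right_unitality := c.pushTens_right h f }

end MonHom

end FibreMonoidal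

section Lift

variable (h : IsCartesianMonoidal P)

theorem eqMap_unit {M N : B} [MonObj M] [MonObj N] {f g : M ⟶ N} [IsMonHom f] [IsMonHom g]
    (e : f = g) :
    (c.pushUnit h f).hom ≫ c.eqMap e (c.unit h M) = (c.pushUnit h g).hom :=
  vert_ext _ _ (c.eps_cocart h N) (by
    rw [comp_val, ← Category.assoc, eps_pushUnit, Category.assoc, hat_eqMap, eps_pushUnit])

theorem eqMap_tens {M N : B} [MonObj M] [MonObj N] {f g : M ⟶ N} [IsMonHom f] [IsMonHom g]
    (e : f = g) (x y : P.Fiber M) :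
    (c.pushTens h f x y).hom ≫ c.eqMap e (c.tens h M x y) =
      c.tensMap h (c.eqMap e x) (c.eqMap e y) ≫ (c.pushTens h g x y).hom :=
  vert_ext _ _ (c.hatL_cocart h f x y) (by
    have e' : (c.hat f x ⊗ₘ c.hat f y) ≫ ((c.eqMap e x).1 ⊗ₘ (c.eqMap e y).1) =
        (c.hat g x ⊗ₘ c.hat g y) := by
      simp only [tensorHom_comp_tensorHom, hat_eqMap]
    rw [comp_val, comp_val, Category.assoc, Category.assoc, hat_pushTens_assoc, hat_eqMap,
      kap_tensMap_assoc, ← Category.assoc, e', hat_pushTens])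

theorem idIso_unit (M : B) [MonObj M] :
    (c.pushUnit h (𝟙 M)).hom ≫ (c.idIso (c.unit h M)).hom = 𝟙 _ :=
  vert_ext _ _ (c.eps_cocart h M) (by
    rw [comp_val, ← Category.assoc, eps_pushUnit, Category.assoc, hat_idIso, id_val])

theorem idIso_tens {M : B} [MonObj M] (x y : P.Fiber M) :
    (c.pushTens h (𝟙 M) x y).hom ≫ (c.idIso (c.tens h M x y)).hom =
      c.tensMap h (c.idIso x).hom (c.idIso y).hom :=
  vert_ext _ _ (c.hatL_cocart h (𝟙 M) x y) (by
    have e' : (c.hat (𝟙 M) x ⊗ₘ c.hat (𝟙 M) y) ≫ ((c.idIso x).hom.1 ⊗ₘ (c.idIso y).hom.1) =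
        𝟙 _ := by
      simp only [tensorHom_comp_tensorHom, hat_idIso, id_tensorHom_id]
    rw [comp_val, Category.assoc, Category.assoc, hat_pushTens_assoc, hat_idIso,
      kap_tensMap, ← Category.assoc, e', Category.id_comp, Category.comp_id])

theorem compIso_unit {M N K : B} [MonObj M] [MonObj N] [MonObj K] (f : M ⟶ N) (g : N ⟶ K)
    [IsMonHom f] [IsMonHom g] :
    (c.pushUnit h (f ≫ g)).hom ≫ (c.compIso f g (c.unit h M)).hom =
      (c.pushUnit h g).hom ≫ c.pushMap g (c.pushUnit h f).hom :=
  vert_ext _ _ (c.eps_cocart h K) (by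
    rw [comp_val, comp_val, ← Category.assoc, eps_pushUnit, Category.assoc, hat_compIso,
      ← Category.assoc (c.eps h K), eps_pushUnit, Category.assoc, hat_pushMap,
      ← Category.assoc (c.eps h N), eps_pushUnit, Category.assoc])

theorem compIso_tens {M N K : B} [MonObj M] [MonObj N] [MonObj K] (f : M ⟶ N) (g : N ⟶ K)
    [IsMonHom f] [IsMonHom g] (x y : P.Fiber M) :
    (c.pushTens h (f ≫ g) x y).hom ≫ (c.compIso f g (c.tens h M x y)).hom =
      c.tensMap h (c.compIso f g x).hom (c.compIso f g y).hom ≫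
        (c.pushTens h g (c.push f x) (c.push f y)).hom ≫ c.pushMap g (c.pushTens h f x y).hom :=
  vert_ext _ _ (c.hatL_cocart h (f ≫ g) x y) (by
    have e' : (c.hat (f ≫ g) x ⊗ₘ c.hat (f ≫ g) y) ≫
        ((c.compIso f g x).hom.1 ⊗ₘ (c.compIso f g y).hom.1) =
        (c.hat f x ⊗ₘ c.hat f y) ≫ (c.hat g (c.push f x) ⊗ₘ c.hat g (c.push f y)) := by
      simp only [tensorHom_comp_tensorHom, hat_compIso]
    simp only [comp_val, Category.assoc]
    rw [hat_pushTens_assoc, hat_compIso, kap_tensMap_assoc, ← Category.assoc (_ ⊗ₘ _), e',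
      Category.assoc, hat_pushTens_assoc, hat_pushMap, hat_pushTens_assoc])

/-- The monoidal category `F(M)`. -/
noncomputable def monFibre (M : Mon B) : MonCAT.{v₁, u₁} :=
  { carrier := P.Fiber M.X
    monoidal := c.fibreMonoidal h M.X }

/-- The strong monoidal functor `F(f)`. -/
noncomputable def monPush {M N : Mon B} (f : M ⟶ N) : c.monFibre h M ⟶ c.monFibre h N :=
  MonCAT.homMk (C := c.monFibre h M) (D := c.monFibre h N) (c.pushFunctor f.hom)
    (c.pushMonoidal h f.hom)

noncomputable def monPushEq {M N : Mon B} {f g : M ⟶ N} (e : f = g) :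
    c.monPush h f ⟶ c.monPush h g :=
  MonCAT.homMk₂ (F := c.monPush h f) (G := c.monPush h g) (c.pushEq (congrArg Mon.Hom.hom e))
    { unit := c.eqMap_unit h (congrArg Mon.Hom.hom e)
      tensor := c.eqMap_tens h (congrArg Mon.Hom.hom e) }

noncomputable def monPushId (M : Mon B) : c.monPush h (𝟙 M) ≅ 𝟙 (c.monFibre h M) :=
  MonCAT.isoMk (F := c.monPush h (𝟙 M)) (G := 𝟙 (c.monFibre h M)) (c.pushId M.X)
    { unit := c.idIso_unit h M.X
      tensor := fun x y => (c.idIso_tens h x y).trans (Category.comp_id _).symm }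

noncomputable def monPushComp {M N K : Mon B} (f : M ⟶ N) (g : N ⟶ K) :
    c.monPush h (f ≫ g) ≅ c.monPush h f ≫ c.monPush h g :=
  MonCAT.isoMk (F := c.monPush h (f ≫ g)) (G := c.monPush h f ≫ c.monPush h g)
    (c.pushComp f.hom g.hom)
    { unit := c.compIso_unit h f.hom g.hom
      tensor := fun x y => c.compIso_tens h f.hom g.hom x y }

section
open scoped Bicategory

/-- The pseudofunctor from the internal monoids of `B` to monoidal categories induced by the lax
monoidal pseudofunctor `F`. -/
noncomputable def monLift : LocallyDiscrete (Mon B) ⥤ᵖ MonCAT.{v₁, u₁} where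
  obj M := c.monFibre h M.as
  map f := c.monPush h f.as
  map₂ η := c.monPushEq h (as_eq η)
  map₂_id f := by
    refine MonCAT.Hom₂.ext (NatTrans.ext (funext fun (x : P.Fiber _) => ?_))
    refine vert_ext f.as.hom _ (c.cocart _ x) ?_
    change c.hat f.as.hom x ≫ (c.eqMap rfl x).1 = c.hat f.as.hom x ≫ 𝟙 _
    simp
  map₂_comp {_ _ f g h} η θ := by
    refine MonCAT.Hom₂.ext (NatTrans.ext (funext fun (x : P.Fiber _) => ?_))
    refine vert_ext f.as.hom _ (c.cocart _ x) ?_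
    change c.hat f.as.hom x ≫ (c.eqMap (congrArg Mon.Hom.hom (as_eq (η ≫ θ))) x).1 =
      c.hat f.as.hom x ≫ (c.eqMap (congrArg Mon.Hom.hom (as_eq η)) x).1 ≫
        (c.eqMap (congrArg Mon.Hom.hom (as_eq θ)) x).1
    simp
  mapId M := c.monPushId h M.as
  mapComp f g := c.monPushComp h f.as g.as
  map₂_whisker_left {_ _ _} f {g h} η := by
    refine MonCAT.Hom₂.ext (NatTrans.ext (funext fun (x : P.Fiber _) => ?_))
    refine vert_ext (f.as.hom ≫ g.as.hom) _ (c.cocart _ x) ?_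
    change c.hat (f.as.hom ≫ g.as.hom) x ≫
        (c.eqMap (f := f.as.hom ≫ g.as.hom) (g := f.as.hom ≫ h.as.hom)
          (congrArg Mon.Hom.hom (as_eq (f ◁ η))) x).1 =
      c.hat (f.as.hom ≫ g.as.hom) x ≫ (c.compIso f.as.hom g.as.hom x).hom.1 ≫
        (c.eqMap (congrArg Mon.Hom.hom (as_eq η)) (c.push f.as.hom x)).1 ≫
          (c.compIso f.as.hom h.as.hom x).inv.1
    refine (c.hat_eqMap _ x).trans ?_
    simp
  map₂_whisker_right {_ _ _} {f g} η h := by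
    refine MonCAT.Hom₂.ext (NatTrans.ext (funext fun (x : P.Fiber _) => ?_))
    refine vert_ext (f.as.hom ≫ h.as.hom) _ (c.cocart _ x) ?_
    change c.hat (f.as.hom ≫ h.as.hom) x ≫
        (c.eqMap (f := f.as.hom ≫ h.as.hom) (g := g.as.hom ≫ h.as.hom)
          (congrArg Mon.Hom.hom (as_eq (η ▷ h))) x).1 =
      c.hat (f.as.hom ≫ h.as.hom) x ≫ (c.compIso f.as.hom h.as.hom x).hom.1 ≫
        (c.pushMap h.as.hom (c.eqMap (congrArg Mon.Hom.hom (as_eq η)) x)).1 ≫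
          (c.compIso g.as.hom h.as.hom x).inv.1
    refine (c.hat_eqMap _ x).trans ?_
    simp
  map₂_associator f g h := by
    refine MonCAT.Hom₂.ext (NatTrans.ext (funext fun (x : P.Fiber _) => ?_))
    refine vert_ext ((f.as.hom ≫ g.as.hom) ≫ h.as.hom) _ (c.cocart _ x) ?_
    change c.hat ((f.as.hom ≫ g.as.hom) ≫ h.as.hom) x ≫
        (c.eqMap (f := (f.as.hom ≫ g.as.hom) ≫ h.as.hom) (g := f.as.hom ≫ g.as.hom ≫ h.as.hom)
          (congrArg Mon.Hom.hom (as_eq (Bicategory.associator f g h).hom)) x).1 =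
      c.hat ((f.as.hom ≫ g.as.hom) ≫ h.as.hom) x ≫
        (c.compIso (f.as.hom ≫ g.as.hom) h.as.hom x).hom.1 ≫
          (c.pushMap h.as.hom (c.compIso f.as.hom g.as.hom x).hom).1 ≫ 𝟙 _ ≫
            (c.compIso g.as.hom h.as.hom (c.push f.as.hom x)).inv.1 ≫
              (c.compIso f.as.hom (g.as.hom ≫ h.as.hom) x).inv.1
    refine (c.hat_eqMap _ x).trans ?_
    simp
  map₂_left_unitor f := by
    refine MonCAT.Hom₂.ext (NatTrans.ext (funext fun (x : P.Fiber _) => ?_))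
    refine vert_ext (𝟙 _ ≫ f.as.hom) _ (c.cocart _ x) ?_
    change c.hat (𝟙 _ ≫ f.as.hom) x ≫
        (c.eqMap (f := 𝟙 _ ≫ f.as.hom) (g := f.as.hom)
          (congrArg Mon.Hom.hom (as_eq (Bicategory.leftUnitor f).hom)) x).1 =
      c.hat (𝟙 _ ≫ f.as.hom) x ≫ (c.compIso (𝟙 _) f.as.hom x).hom.1 ≫
        (c.pushMap f.as.hom (c.idIso x).hom).1 ≫ 𝟙 _
    refine (c.hat_eqMap _ x).trans ?_
    simp
  map₂_right_unitor f := by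
    refine MonCAT.Hom₂.ext (NatTrans.ext (funext fun (x : P.Fiber _) => ?_))
    refine vert_ext (f.as.hom ≫ 𝟙 _) _ (c.cocart _ x) ?_
    change c.hat (f.as.hom ≫ 𝟙 _) x ≫
        (c.eqMap (f := f.as.hom ≫ 𝟙 _) (g := f.as.hom)
          (congrArg Mon.Hom.hom (as_eq (Bicategory.rightUnitor f).hom)) x).1 =
      c.hat (f.as.hom ≫ 𝟙 _) x ≫ (c.compIso f.as.hom (𝟙 _) x).hom.1 ≫
        (c.idIso (c.push f.as.hom x)).hom.1 ≫ 𝟙 _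
    refine (c.hat_eqMap _ x).trans ?_
    simp

theorem pseudofunctor_ext {C D : Type*} [Bicategory C] [Bicategory D] {F G : C ⥤ᵖ D}
    (e : F.toPrelaxFunctor = G.toPrelaxFunctor) (e₁ : F.mapId ≍ G.mapId)
    (e₂ : @F.mapComp ≍ @G.mapComp) : F = G := by
  cases F
  cases G
  cases e
  cases e₁
  cases e₂
  rfl

/-- On underlying categories, `monLift` is `F`. -/
theorem monLift_forget : (c.monLift h).comp MonCAT.forget =
    (Mon.forget B).toPseudofunctor.comp c.pseudofunctor := by
  refine pseudofunctor_ext rfl (heq_of_eq (funext fun M => Iso.ext ?_))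
    (heq_of_eq (funext fun _ => funext fun _ => funext fun _ => funext fun f => funext fun g =>
      Iso.ext ?_))
  · refine Cat.Hom₂.ext (NatTrans.ext (funext fun (x : P.Fiber _) => ?_))
    refine vert_ext _ _ (c.cocart _ x) ?_
    change c.hat (𝟙 M.as.X) x ≫ (c.idIso x).hom.1 ≫ 𝟙 _ =
      c.hat (𝟙 M.as.X) x ≫ (c.eqMap (rfl : 𝟙 M.as.X = 𝟙 M.as.X) x).1 ≫ (c.idIso x).hom.1
    simp
  · refine Cat.Hom₂.ext (NatTrans.ext (funext fun (x : P.Fiber _) => ?_))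
    refine vert_ext _ _ (c.cocart _ x) ?_
    change c.hat (f.as.hom ≫ g.as.hom) x ≫ (c.compIso f.as.hom g.as.hom x).hom.1 ≫ 𝟙 _ =
      c.hat (f.as.hom ≫ g.as.hom) x ≫
        (c.eqMap (rfl : f.as.hom ≫ g.as.hom = f.as.hom ≫ g.as.hom) x).1 ≫
          (c.compIso f.as.hom g.as.hom x).hom.1
    simp

/-- The lax monoidal pseudofunctor `F` is groupal: the pseudofunctor induced by `F` on internal
monoids restricts to a pseudofunctor from the internal groups of `B` to 2-groups, which therefore
lifts `F` along the forgetful functors. -/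
def IsGroupal : Prop :=
  ∃ G : LocallyDiscrete (Grp B) ⥤ᵖ TwoGrp.{v₁, u₁},
    G.comp TwoGrp.toMonCAT = (Grp.forget₂Mon B).toPseudofunctor.comp (c.monLift h) ∧
    G.comp TwoGrp.toCat = (Grp.forget B).toPseudofunctor.comp c.pseudofunctor

end

/-- For an internal group `A` of `B`, the functor `F(i)` induced by the inversion `i : A ⟶ A`
provides pseudoinverses in the monoidal category `F(A)`: there are natural isomorphisms
`coev : E ≅ x ⊗ F(i)(x)` and `ev : F(i)(x) ⊗ x ≅ E` satisfying the triangle identities. -/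
def HasInversePseudoinverses (A : B) [GrpObj A] : Prop :=
  letI := c.fibreMonoidal h A
  let Fi := c.pushFunctor (GrpObj.inv : A ⟶ A)
  ∃ (coev : ∀ x : P.Fiber A, 𝟙_ (P.Fiber A) ≅ x ⊗ Fi.obj x)
    (ev : ∀ x : P.Fiber A, Fi.obj x ⊗ x ≅ 𝟙_ (P.Fiber A)),
    (∀ (x y : P.Fiber A) (k : x ⟶ y), (coev x).hom ≫ (k ⊗ₘ Fi.map k) = (coev y).hom) ∧
    (∀ (x y : P.Fiber A) (k : x ⟶ y), (Fi.map k ⊗ₘ k) ≫ (ev y).hom = (ev x).hom) ∧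
    (∀ x : P.Fiber A, (coev x).hom ▷ x ≫ (α_ x (Fi.obj x) x).hom ≫ x ◁ (ev x).hom =
      (λ_ x).hom ≫ (ρ_ x).inv) ∧
    (∀ x : P.Fiber A, Fi.obj x ◁ (coev x).hom ≫ (α_ (Fi.obj x) x (Fi.obj x)).inv ≫
      (ev x).hom ▷ Fi.obj x = (ρ_ (Fi.obj x)).hom ≫ (λ_ (Fi.obj x)).inv)

end Lift

end Cleavage
end Cartesian
end GroupalOpfib

/-!
The three conditions are compared through the cocartesian arrows they provide.

A lift of `F` to 2-groups makes every fibre over an internal group a groupoid. Since the terminal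
object and `A × A` (for `A` an internal group) are internal groups, the components of `η¹` and
`η^{A,A}`, which live in the fibres over these objects, are then automatically invertible
(`isIso_units`).

Conversely, if `η¹` is invertible, then `x ⟶ I` is cocartesian for every object `x`
(`toUnit_cocart`), and if `η^{A,A}` is invertible, then the diagonal of every `x` over `A` is
cocartesian (`diag_cocart`), hence so is every pairing of cocartesian arrows out of `x`
(`lift_cocart`). For an internal group `A` with inversion `i`, the arrows `x ⟶ I ⟶ E` and
`x ⟶ x × i_* x ⟶ x ⊗ i_* x` are therefore both cocartesian over the constant map `A ⟶ I ⟶ A`, which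
gives `E ≅ x ⊗ i_* x`, and symmetrically `i_* x ⊗ x ≅ E` (`coevIso`, `evIso`). Naturality and the
triangle identities hold because both sides agree after composition with a cocartesian arrow; the
two sides of the triangle identities become the same map out of `x`, by way of the triple diagonal.

As `i_*` is covariant, the naturality of these dualities turns the mate of `i_* k` into an inverse
of any vertical arrow `k` (`isIso_of_natural_coev_ev`). So `F(A)` is a 2-group for every internal group
`A`, and the pseudofunctor to monoidal categories corestricts to 2-groups, without change of its
data (`isGroupal_of_isTwoGroup`).
-/

namespace GroupalOpfib

/-! ### Pseudofunctors into a full sub-bicategory -/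

section Bicategorical

open scoped Bicategory

/-- A pseudofunctor all of whose values satisfy `p`, corestricted to the full sub-bicategory on the
objects satisfying `p`. -/
def corestrict {D C : Type*} [Bicategory D] [Bicategory C] (p : C → Prop) (F : D ⥤ᵖ C)
    (hF : ∀ d, p (F.obj d)) :
    D ⥤ᵖ Bicategory.InducedBicategory C (fun x : {x : C // p x} => x.1) where
  obj d := (⟨F.obj d, hF d⟩ : {x : C // p x})
  map f := Bicategory.InducedBicategory.mkHom (F.map f)
  map₂ η := Bicategory.InducedBicategory.mkHom₂ (F.map₂ η)
  map₂_id f := Bicategory.InducedBicategory.hom₂_ext (F.map₂_id f)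
  map₂_comp η θ := Bicategory.InducedBicategory.hom₂_ext (F.map₂_comp η θ)
  mapId d := Bicategory.InducedBicategory.isoMk (F.mapId d)
  mapComp f g := Bicategory.InducedBicategory.isoMk (F.mapComp f g)
  map₂_whisker_left f _ _ η :=
    Bicategory.InducedBicategory.hom₂_ext (F.map₂_whisker_left f η)
  map₂_whisker_right η f :=
    Bicategory.InducedBicategory.hom₂_ext (F.map₂_whisker_right η f)
  map₂_associator f g k :=
    Bicategory.InducedBicategory.hom₂_ext (F.map₂_associator f g k)
  map₂_left_unitor f := Bicategory.InducedBicategory.hom₂_ext (F.map₂_left_unitor f)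
  map₂_right_unitor f := Bicategory.InducedBicategory.hom₂_ext (F.map₂_right_unitor f)

theorem corestrict_comp_forget {D C : Type*} [Bicategory D] [Bicategory C] (p : C → Prop)
    (F : D ⥤ᵖ C) (hF : ∀ d, p (F.obj d)) :
    (corestrict p F hF).comp Bicategory.InducedBicategory.forget.toPseudofunctor = F := by
  refine Cleavage.pseudofunctor_ext rfl (heq_of_eq (funext fun d => Iso.ext ?_))
    (heq_of_eq (funext fun _ => funext fun _ => funext fun _ => funext fun f => funext fun g =>
      Iso.ext ?_))
  · exact Category.comp_id (F.mapId d).hom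
  · exact Category.comp_id (F.mapComp f g).hom

theorem pseudofunctor_comp_assoc {C₁ C₂ C₃ C₄ : Type*} [Bicategory C₁] [Bicategory C₂]
    [Bicategory C₃] [Bicategory C₄] (F : C₁ ⥤ᵖ C₂) (G : C₂ ⥤ᵖ C₃) (H : C₃ ⥤ᵖ C₄) :
    (F.comp G).comp H = F.comp (G.comp H) := by
  refine Cleavage.pseudofunctor_ext rfl (heq_of_eq (funext fun d => Iso.ext ?_))
    (heq_of_eq (funext fun _ => funext fun _ => funext fun _ => funext fun f => funext fun g =>
      Iso.ext ?_))
  · exact (congrArg (· ≫ _) (H.map₂_comp _ _)).trans (Category.assoc _ _ _)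
  · exact (congrArg (· ≫ _) (H.map₂_comp _ _)).trans (Category.assoc _ _ _)

theorem toPseudofunctor_comp {C₁ C₂ C₃ : Type*} [Category C₁] [Category C₂] [Category C₃]
    (F : C₁ ⥤ C₂) (G : C₂ ⥤ C₃) :
    F.toPseudofunctor.comp G.toPseudofunctor = (F ⋙ G).toPseudofunctor := by
  refine Cleavage.pseudofunctor_ext rfl (heq_of_eq (funext fun d => Iso.ext ?_))
    (heq_of_eq (funext fun _ => funext fun _ => funext fun _ => funext fun f => funext fun g =>
      Iso.ext ?_))
  · exact Subsingleton.elim _ _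
  · exact Subsingleton.elim _ _

end Bicategorical

/-! ### Natural duals of covariant type force a groupoid -/

open MonoidalCategory

/-- If every object `x` of a monoidal category has a dual `S x`, covariantly functorial in `x`,
whose coevaluation and evaluation are natural with respect to simultaneous transport along `k` and `S k`,
then every arrow `k : x ⟶ y` is invertible: `S k` points in the same direction as `k`, and its mate
`y ⟶ x` is the inverse. -/
theorem isIso_of_natural_coev_ev {C : Type*} [Category C] [MonoidalCategory C] (S : C ⥤ C)
    (coev : ∀ x : C, 𝟙_ C ⟶ x ⊗ S.obj x) (ev : ∀ x : C, S.obj x ⊗ x ⟶ 𝟙_ C)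
    (hcoev : ∀ {x y : C} (k : x ⟶ y), coev x ≫ (k ⊗ₘ S.map k) = coev y)
    (hev : ∀ {x y : C} (k : x ⟶ y), (S.map k ⊗ₘ k) ≫ ev y = ev x)
    (htri : ∀ x : C, coev x ▷ x ≫ (α_ x (S.obj x) x).hom ≫ x ◁ ev x = (λ_ x).hom ≫ (ρ_ x).inv)
    {x y : C} (k : x ⟶ y) : IsIso k := by
  refine ⟨(λ_ y).inv ≫ coev x ▷ y ≫ (x ◁ S.map k) ▷ y ≫ (α_ x (S.obj y) y).hom ≫ x ◁ ev y ≫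
    (ρ_ x).hom, ?_, ?_⟩
  · have e : k ≫ (λ_ y).inv ≫ coev x ▷ y ≫ (x ◁ S.map k) ▷ y ≫ (α_ x (S.obj y) y).hom ≫
        x ◁ ev y ≫ (ρ_ x).hom = (λ_ x).inv ≫ coev x ▷ x ≫ (α_ x (S.obj x) x).hom ≫
          x ◁ ((S.map k ⊗ₘ k) ≫ ev y) ≫ (ρ_ x).hom := by
      rw [tensorHom_def']
      simp only [MonoidalCategory.whiskerLeft_comp, Category.assoc]
      rw [← associator_naturality_right_assoc, ← associator_naturality_middle_assoc,
        ← whisker_exchange_assoc, ← leftUnitor_inv_naturality_assoc]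
    rw [e, hev]
    have := htri x
    rw [reassoc_of% this]
    simp
  · have e : ((λ_ y).inv ≫ coev x ▷ y ≫ (x ◁ S.map k) ▷ y ≫ (α_ x (S.obj y) y).hom ≫
        x ◁ ev y ≫ (ρ_ x).hom) ≫ k = (λ_ y).inv ≫ (coev x ≫ (k ⊗ₘ S.map k)) ▷ y ≫
          (α_ y (S.obj y) y).hom ≫ y ◁ ev y ≫ (ρ_ y).hom := by
      rw [tensorHom_def']
      simp only [comp_whiskerRight, Category.assoc]
      rw [associator_naturality_left_assoc, ← whisker_exchange_assoc, rightUnitor_naturality]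
    rw [e, hcoev]
    have := htri y
    rw [reassoc_of% this]
    simp

/-! ### Cocartesian projections and diagonals -/

theorem vert_cocart {X : Type u₁} [Category.{v₁} X] {B : Type u₂} [Category.{v₂} B] {P : X ⥤ B}
    {A : B} {x y : P.Fiber A} (k : x ⟶ y) [IsIso k] : P.IsStronglyCocartesian (𝟙 A) k.1 := by
  have := k.2
  have : IsIso k.1 := inferInstanceAs (IsIso ((Functor.Fiber.fiberInclusion (p := P)).map k))
  infer_instance

open CartesianMonoidalCategory MonObj

variable {X : Type u₁} [Category.{v₁} X] [CartesianMonoidalCategory X]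
  {B : Type u₂} [Category.{v₂} B] [CartesianMonoidalCategory B] {P : X ⥤ B}

namespace Cleavage

variable (c : Cleavage P) (h : IsCartesianMonoidal P)

include c in
/-- If `η¹` is invertible, then the arrow from any object to the terminal object is cocartesian. -/
theorem toUnit_cocart (hI : IsIso (adj₁ h).unit) {A : B} (x : P.Fiber A) :
    P.IsStronglyCocartesian (toUnit A) (toUnit x.1) := by
  let k : c.push (toUnit A) x ⟶ unitObj h := (adj₁ h).unit.app (c.push (toUnit A) x)
  have : IsIso k :=
    inferInstanceAs (IsIso ((adj₁ h).unit.app (c.push (toUnit A) x)))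
  have e := cocart_comp (c.cocart (toUnit A) x) (vert_cocart k)
  rw [Category.comp_id] at e
  have e' : toUnit x.1 = c.hat (toUnit A) x ≫ k.1 := toUnit_unique _ _
  rw [e']
  exact e

/-- If `η^{A,A}` is invertible, then diagonals of objects over `A` are cocartesian: up to the
invertible unit at `Δ_* x`, the diagonal is the lifting of `Δ : A ⟶ A × A`. -/
theorem diag_cocart {A : B} (hA : IsIso (c.adj h A A).unit) (x : P.Fiber A) :
    P.IsStronglyCocartesian (lift (𝟙 A) (𝟙 A)) (lift (𝟙 x.1) (𝟙 x.1)) := by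
  let z := c.push (lift (𝟙 A) (𝟙 A)) x
  have : IsIso (c.unitLR h z) := inferInstanceAs (IsIso ((c.adj h A A).unit.app z))
  -- the composites `x ⟶ Δ_* x ⟶ (πⱼ)_* Δ_* x` are cocartesian over the identity
  have e₁ : P.IsStronglyCocartesian (𝟙 A) (c.hat (lift (𝟙 A) (𝟙 A)) x ≫ c.hat (fst A A) z) := by
    have := cocart_comp (c.cocart (lift (𝟙 A) (𝟙 A)) x) (c.cocart (fst A A) z)
    rwa [lift_fst] at this
  have e₂ : P.IsStronglyCocartesian (𝟙 A) (c.hat (lift (𝟙 A) (𝟙 A)) x ≫ c.hat (snd A A) z) := by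
    have := cocart_comp (c.cocart (lift (𝟙 A) (𝟙 A)) x) (c.cocart (snd A A) z)
    rwa [lift_snd] at this
  have f₁ := fac _ _ e₁ _ (cocart_id x).toIsHomLift
  have f₂ := fac _ _ e₂ _ (cocart_id x).toIsHomLift
  let a := descIso _ _ e₁ _ (cocart_id x)
  let b := descIso _ _ e₂ _ (cocart_id x)
  have e := cocart_comp (cocart_comp (c.cocart (lift (𝟙 A) (𝟙 A)) x) (vert_cocart (c.unitLR h z)))
    (h.tensor_cocart (vert_cocart a.hom) (vert_cocart b.hom))
  rw [id_tensorHom_id, Category.comp_id, Category.comp_id] at e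
  convert e using 1
  change _ = (c.hat (lift (𝟙 A) (𝟙 A)) x ≫ lift (c.hat (fst A A) z) (c.hat (snd A A) z)) ≫ _
  rw [comp_lift, lift_map]
  exact congrArg₂ lift f₁.symm f₂.symm

/-- If `η^{A,A}` is invertible, then pairings of cocartesian arrows with a common domain over `A`
are cocartesian. -/
theorem lift_cocart {A C D : B} (hA : IsIso (c.adj h A A).unit) {x : P.Fiber A} {y z : X}
    {f : A ⟶ C} {g : A ⟶ D} {φ : x.1 ⟶ y} {ψ : x.1 ⟶ z} (hφ : P.IsStronglyCocartesian f φ)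
    (hψ : P.IsStronglyCocartesian g ψ) : P.IsStronglyCocartesian (lift f g) (lift φ ψ) := by
  have e := cocart_comp (c.diag_cocart h hA x) (h.tensor_cocart hφ hψ)
  rwa [lift_map, lift_map, Category.id_comp, Category.id_comp, Category.id_comp,
    Category.id_comp] at e

/-! ### Pseudoinverses in the fibre over an internal group -/

section Inverse

variable {A : B} [GrpObj A] (hI : IsIso (adj₁ h).unit) (hA : IsIso (c.adj h A A).unit)

include hI in
theorem toUnit_eps_cocart (x : P.Fiber A) :
    P.IsStronglyCocartesian (toUnit A ≫ η[A]) (toUnit x.1 ≫ c.eps h A) :=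
  cocart_comp (c.toUnit_cocart h hI x) (c.eps_cocart h A)

include hA in
theorem lift_hat_inv_kap_cocart (x : P.Fiber A) : P.IsStronglyCocartesian (toUnit A ≫ η[A])
    (lift (𝟙 x.1) (c.hat ι[A] x) ≫ c.kap h A x (c.push ι[A] x)) := by
  rw [← GrpObj.right_inv A]
  exact cocart_comp (c.lift_cocart h hA (cocart_id x) (c.cocart _ x)) (c.kap_cocart h A _ _)

include hA in
theorem lift_inv_hat_kap_cocart (x : P.Fiber A) : P.IsStronglyCocartesian (toUnit A ≫ η[A])
    (lift (c.hat ι[A] x) (𝟙 x.1) ≫ c.kap h A (c.push ι[A] x) x) := by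
  rw [← GrpObj.left_inv A]
  exact cocart_comp (c.lift_cocart h hA (c.cocart _ x) (cocart_id x)) (c.kap_cocart h A _ _)

/-- The isomorphism `E ≅ x ⊗ F(i)(x)`: both sides are codomains of cocartesian arrows from `x` over
the constant map `A ⟶ I ⟶ A`. -/
noncomputable def coevIso (x : P.Fiber A) : c.unit h A ≅ c.tens h A x (c.push ι[A] x) :=
  descIso _ _ (c.toUnit_eps_cocart h hI x) _ (c.lift_hat_inv_kap_cocart h hA x)

/-- The isomorphism `F(i)(x) ⊗ x ≅ E`, obtained in the same way as `coevIso`. -/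
noncomputable def evIso (x : P.Fiber A) : c.tens h A (c.push ι[A] x) x ≅ c.unit h A :=
  descIso _ _ (c.lift_inv_hat_kap_cocart h hA x) _ (c.toUnit_eps_cocart h hI x)

theorem eps_coevIso (x : P.Fiber A) : toUnit x.1 ≫ c.eps h A ≫ (c.coevIso h hI hA x).hom.1 =
    lift (𝟙 x.1) (c.hat ι[A] x) ≫ c.kap h A x (c.push ι[A] x) := by
  rw [← Category.assoc]
  exact fac _ _ (c.toUnit_eps_cocart h hI x) _ _

theorem kap_evIso (x : P.Fiber A) : lift (c.hat ι[A] x) (𝟙 x.1) ≫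
    c.kap h A (c.push ι[A] x) x ≫ (c.evIso h hI hA x).hom.1 = toUnit x.1 ≫ c.eps h A := by
  rw [← Category.assoc]
  exact fac _ _ (c.lift_inv_hat_kap_cocart h hA x) _ _

theorem coevIso_naturality {x y : P.Fiber A} (k : x ⟶ y) :
    (c.coevIso h hI hA x).hom ≫ c.tensMap h k (c.pushMap ι[A] k) = (c.coevIso h hI hA y).hom := by
  refine vert_ext _ _ (c.toUnit_eps_cocart h hI x) ?_
  rw [comp_val, Category.assoc, reassoc_of% (c.eps_coevIso h hI hA x),
    kap_tensMap, lift_map_assoc, hat_pushMap,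
    Category.id_comp, ← comp_toUnit k.1, Category.assoc, Category.assoc, eps_coevIso,
    comp_lift_assoc, Category.comp_id]

theorem evIso_naturality {x y : P.Fiber A} (k : x ⟶ y) :
    c.tensMap h (c.pushMap ι[A] k) k ≫ (c.evIso h hI hA y).hom = (c.evIso h hI hA x).hom := by
  refine vert_ext _ _ (c.lift_inv_hat_kap_cocart h hA x) ?_
  rw [comp_val, Category.assoc, Category.assoc, kap_tensMap_assoc, kap_evIso, lift_map_assoc,
    hat_pushMap, Category.id_comp, ← comp_toUnit k.1, Category.assoc, ← c.kap_evIso h hI hA y,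
    comp_lift_assoc, Category.comp_id]

/-- In `X`, the inverse of the left unit constraint is `x ≅ I × x ⟶ E × x ⟶ E ⊗ x`. -/
theorem tensLeft_inv_val (x : P.Fiber A) : (c.tensLeft h x).inv.1 =
    lift (toUnit x.1 ≫ c.eps h A) (𝟙 x.1) ≫ c.kap h A (c.unit h A) x := by
  have e : (lift (toUnit x.1 ≫ c.eps h A) (𝟙 x.1) ≫ c.kap h A (c.unit h A) x) ≫
      (c.tensLeft h x).hom.1 = 𝟙 x.1 := by
    have := congrArg (lift (toUnit x.1) (𝟙 x.1) ≫ ·) (c.kap_tensLeft h x)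
    rw [lift_map_assoc, Category.comp_id, lift_leftUnitor_hom] at this
    rw [Category.assoc, this]
  have e' := congrArg Subtype.val (c.tensLeft h x).hom_inv_id
  rw [comp_val, id_val] at e'
  rw [← Category.comp_id (_ ≫ c.kap h A (c.unit h A) x), ← e', ← Category.assoc, e,
    Category.id_comp]

/-- In `X`, the inverse of the right unit constraint is `x ≅ x × I ⟶ x × E ⟶ x ⊗ E`. -/
theorem tensRight_inv_val (x : P.Fiber A) : (c.tensRight h x).inv.1 =
    lift (𝟙 x.1) (toUnit x.1 ≫ c.eps h A) ≫ c.kap h A x (c.unit h A) := by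
  have e : (lift (𝟙 x.1) (toUnit x.1 ≫ c.eps h A) ≫ c.kap h A x (c.unit h A)) ≫
      (c.tensRight h x).hom.1 = 𝟙 x.1 := by
    have := congrArg (lift (𝟙 x.1) (toUnit x.1) ≫ ·) (c.kap_tensRight h x)
    rw [lift_map_assoc, Category.comp_id, lift_rightUnitor_hom] at this
    rw [Category.assoc, this]
  have e' := congrArg Subtype.val (c.tensRight h x).hom_inv_id
  rw [comp_val, id_val] at e'
  rw [← Category.comp_id (_ ≫ c.kap h A x (c.unit h A)), ← e', ← Category.assoc, e,
    Category.id_comp]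

/-- The first triangle identity. Precomposed with `x ≅ E ⊗ x`, the left side factors through the
triple pairing `x ⟶ (x × i_* x) × x`, and both sides are the pairing of `𝟙 x` and `x ⟶ I ⟶ E`
followed by the lifting `x × E ⟶ x ⊗ E`. -/
theorem coevIso_evIso (x : P.Fiber A) : c.tensMap h (c.coevIso h hI hA x).hom (𝟙 x) ≫
    (c.tensAssoc h x (c.push ι[A] x) x).hom ≫ c.tensMap h (𝟙 x) (c.evIso h hI hA x).hom =
      (c.tensLeft h x).hom ≫ (c.tensRight h x).inv := by
  rw [← Iso.inv_comp_eq]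
  refine Subtype.ext ?_
  have e : lift (lift (𝟙 x.1) (c.hat ι[A] x) ≫ c.kap h A x (c.push ι[A] x)) (𝟙 x.1) =
      lift (lift (𝟙 x.1) (c.hat ι[A] x)) (𝟙 x.1) ≫ (c.kap h A x (c.push ι[A] x) ⊗ₘ 𝟙 x.1) := by
    rw [lift_map, Category.comp_id]
  simp only [comp_val, id_val, tensLeft_inv_val, tensRight_inv_val, Category.assoc,
    kap_tensMap_assoc, lift_map_assoc, eps_coevIso, Category.comp_id]
  rw [e, Category.assoc, kap_tensAssoc_assoc, kap_tensMap, lift_lift_associator_hom_assoc,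
    lift_map_assoc, id_val, lift_map_assoc, Category.assoc, Category.assoc, kap_evIso,
    Category.comp_id, Category.comp_id]

/-- The second triangle identity. It suffices to check it after composition with the cocartesian
lifting `x ⟶ i_* x`, where both sides factor through the triple pairing
`x ⟶ (i_* x × x) × i_* x`. -/
theorem evIso_coevIso (x : P.Fiber A) :
    c.tensMap h (𝟙 (c.push ι[A] x)) (c.coevIso h hI hA x).hom ≫
    (c.tensAssoc h (c.push ι[A] x) x (c.push ι[A] x)).inv ≫
      c.tensMap h (c.evIso h hI hA x).hom (𝟙 (c.push ι[A] x)) =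
      (c.tensRight h (c.push ι[A] x)).hom ≫ (c.tensLeft h (c.push ι[A] x)).inv := by
  rw [← Iso.inv_comp_eq]
  refine vert_ext _ _ (c.cocart ι[A] x) ?_
  have e : lift (c.hat ι[A] x) (lift (𝟙 x.1) (c.hat ι[A] x) ≫ c.kap h A x (c.push ι[A] x)) ≫
      c.kap h A (c.push ι[A] x) (c.tens h A x (c.push ι[A] x)) =
      lift (lift (c.hat ι[A] x) (𝟙 x.1) ≫ c.kap h A (c.push ι[A] x) x) (c.hat ι[A] x) ≫
        c.kap h A (c.tens h A (c.push ι[A] x) x) (c.push ι[A] x) ≫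
          (c.tensAssoc h (c.push ι[A] x) x (c.push ι[A] x)).hom.1 := by
    have := congrArg (lift (lift (c.hat ι[A] x) (𝟙 x.1)) (c.hat ι[A] x) ≫ ·)
      (c.kap_tensAssoc h (c.push ι[A] x) x (c.push ι[A] x))
    rw [lift_map_assoc, lift_lift_associator_hom_assoc, lift_map_assoc, Category.comp_id] at this
    exact this.symm
  have e' := congrArg Subtype.val (c.tensAssoc h (c.push ι[A] x) x (c.push ι[A] x)).hom_inv_id
  rw [comp_val, id_val] at e'
  have t : c.hat ι[A] x ≫ toUnit (c.push ι[A] x).1 = toUnit x.1 := comp_toUnit _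
  simp only [comp_val, tensLeft_inv_val, tensRight_inv_val, Category.assoc, kap_tensMap_assoc,
    comp_lift_assoc, lift_map_assoc, id_val, Category.comp_id, reassoc_of% t, eps_coevIso]
  rw [reassoc_of% e, reassoc_of% e', kap_tensMap, lift_map_assoc, Category.assoc, kap_evIso,
    id_val, Category.comp_id]

include hI hA in
theorem hasInversePseudoinverses : c.HasInversePseudoinverses h A :=
  ⟨c.coevIso h hI hA, c.evIso h hI hA, fun _ _ k => c.coevIso_naturality h hI hA k,
    fun _ _ k => c.evIso_naturality h hI hA k, c.coevIso_evIso h hI hA, c.evIso_coevIso h hI hA⟩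

/-- Pseudoinverses provided by `F(i)` make `F(A)` a 2-group; they also force it to be a groupoid. -/
theorem HasInversePseudoinverses.isTwoGroup (H : c.HasInversePseudoinverses h A) :
    letI := c.fibreMonoidal h A
    IsTwoGroup (P.Fiber A) := by
  let := c.fibreMonoidal h A
  obtain ⟨coev, ev, hcoev, hev, htri, -⟩ := H
  refine ⟨⟨fun k => ?_⟩, fun x => ⟨_, ⟨(coev x).symm⟩, ⟨ev x⟩⟩⟩
  exact isIso_of_natural_coev_ev (c.pushFunctor ι[A]) (fun x => (coev x).hom) (fun x => (ev x).hom)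
    (fun k => hcoev _ _ k) (fun k => hev _ _ k) htri k

end Inverse

/-! ### Groupal pseudofunctors -/

/-- If the fibre over every internal group is a 2-group, then `F` is groupal. -/
theorem isGroupal_of_isTwoGroup
    (H : ∀ A : Grp B, IsTwoGroup (c.monFibre h A.toMon).carrier) : c.IsGroupal h := by
  have e := corestrict_comp_forget (fun C : MonCAT.{v₁, u₁} => IsTwoGroup C.carrier)
    ((Grp.forget₂Mon B).toPseudofunctor.comp (c.monLift h)) (fun A => H A.as)
  refine ⟨corestrict _ ((Grp.forget₂Mon B).toPseudofunctor.comp (c.monLift h))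
    (fun A => H A.as), e, ?_⟩
  refine (pseudofunctor_comp_assoc _ _ _).symm.trans ((congrArg (·.comp MonCAT.forget) e).trans ?_)
  rw [pseudofunctor_comp_assoc, monLift_forget, ← pseudofunctor_comp_assoc, toPseudofunctor_comp]
  rfl

omit [CartesianMonoidalCategory X] in
/-- If `F` lifts to 2-groups, then the fibres over internal groups are groupoids. -/
theorem isGroupoid_fiber (G : Pseudofunctor (LocallyDiscrete (Grp B)) TwoGrp.{v₁, u₁})
    (hG : G.comp TwoGrp.toCat = (Grp.forget B).toPseudofunctor.comp c.pseudofunctor)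
    (A : B) [GrpObj A] : IsGroupoid (P.Fiber A) := by
  have e : (G.comp TwoGrp.toCat).obj ⟨⟨A⟩⟩ = Cat.of (P.Fiber A) := by
    rw [hG]
    rfl
  have key : IsGroupoid ((G.comp TwoGrp.toCat).obj ⟨⟨A⟩⟩) := (G.obj ⟨⟨A⟩⟩).2.isGroupoid
  rw [e] at key
  exact key

/-- In a groupoid the unit components are invertible for free: if `F` lifts to 2-groups, then `F(I)`
and `F(A × A)` are groupoids, as `I` and `A × A` are internal groups. -/
theorem isIso_units (G : Pseudofunctor (LocallyDiscrete (Grp B)) TwoGrp.{v₁, u₁})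
    (hG : G.comp TwoGrp.toCat = (Grp.forget B).toPseudofunctor.comp c.pseudofunctor) :
    IsIso (adj₁ h).unit ∧ ∀ A : B, Nonempty (GrpObj A) → IsIso (c.adj h A A).unit := by
  refine ⟨?_, fun A ⟨_⟩ => ?_⟩
  · have := c.isGroupoid_fiber G hG (𝟙_ B)
    exact NatIso.isIso_of_isIso_app _
  · -- the product of two internal groups is an internal group for the canonical symmetry
    let := BraidedCategory.ofCartesianMonoidalCategory (C := B)
    have := c.isGroupoid_fiber G hG (A ⊗ A)
    exact NatIso.isIso_of_isIso_app _

end Cleavage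

end GroupalOpfib

theorem theorem5p3 {X : Type u₁} [Category.{v₁} X] [CartesianMonoidalCategory X]
    {B : Type u₂} [Category.{v₂} B] [CartesianMonoidalCategory B] (P : X ⥤ B)
    (c : GroupalOpfib.Cleavage P) (h : GroupalOpfib.IsCartesianMonoidal P) :
    List.TFAE
      [IsIso (GroupalOpfib.Cleavage.adj₁ h).unit ∧
          ∀ (A : B), Nonempty (GrpObj A) → IsIso (c.adj h A A).unit,
        c.IsGroupal h,
        ∃ G : Pseudofunctor (LocallyDiscrete (Grp B)) GroupalOpfib.TwoGrp.{v₁, u₁},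
          G.comp GroupalOpfib.TwoGrp.toCat =
            (Grp.forget B).toPseudofunctor.comp c.pseudofunctor] ∧
    (c.IsGroupal h → ∀ (A : B) [GrpObj A], c.HasInversePseudoinverses h A) := by
  refine ⟨?_, fun ⟨G, _, hG⟩ A _ => ?_⟩
  · tfae_have 1 → 2 := fun ⟨hI, hA⟩ => c.isGroupal_of_isTwoGroup h fun A =>
      GroupalOpfib.Cleavage.HasInversePseudoinverses.isTwoGroup c h
        (c.hasInversePseudoinverses h hI (hA A.X ⟨A.grp⟩))
    tfae_have 2 → 3 := fun ⟨G, _, hG⟩ => ⟨G, hG⟩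
    tfae_have 3 → 1 := fun ⟨G, hG⟩ => c.isIso_units h G hG
    tfae_finish
  · obtain ⟨hI, hA⟩ := c.isIso_units h G hG
    exact c.hasInversePseudoinverses h hI (hA A ⟨inferInstance⟩)
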